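/- **Setting.** There are $n$ clients with differentiable losses $\mathcal L_i:\mathbb R^d\to\mathbb R$ and importances $p_i\ge 0$, $\sum_i p_i=1$; let $\mathcal L=\sum_i p_i\mathcal L_i$, and assume that $\mathcal L$ has a minimizer $\theta^*$. Assume: (i) every $\nabla\mathcal L_i$ is $L$-Lipschitz; (ii) $\sum_i p_i\|\nabla\mathcal L_i(x)\|^2\le\beta^2\|\sum_i p_i\nabla\mathcal L_i(x)\|^2+\kappa^2$ for all $x$, where $\beta^2\ge1$; (iii) the stochastic gradients satisfy $\mathbb E_\xi[g_i(x,\xi)]=\nabla\mathcal L_i(x)$ and $\mathbb E_\xi\|g_i(x,\xi)-\nabla\mathcal L_i(x)\|^2\le\sigma^2$. FedAvg: in round $t$, a tuple $S_t$ of $m\ge1$ clients is sampled; each client $i$ starts at $y_{i,0}=\theta^t$ and makes $K\ge1$ local steps $y_{i,k+1}=y_{i,k}-\eta_l\,g_i(y_{i,k},\xi_{t,i,k})$ with $\eta_l>0$; and $\theta^{t+1}=\theta^t+\eta_g\sum_i\omega_i(S_t)(y_{i,K}-\theta^t)$ with $\eta_g>0$, where $\omega_i(S)$ is the proportion of the $m$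 draws in $S$ equal to $i$. The initial model $\theta^0$ is deterministic, and all samples $S_t$ and batches $\xi_{t,i,k}$ are mutually independent. *Clustered sampling*: the $k$-th client ($1\le k\le m$) is drawn, independently of the others, from a distribution $(r_{k,i})_{i}$ on the clients (so $r_{k,i}\ge0$, $\sum_i r_{k,i}=1$), with $\sum_k r_{k,i}=m\,p_i$ for all $i$. *MD sampling* is the special case $r_{k,i}=p_i$; we write $S_{Cl}$, $S_{MD}$ for the samples, $\alpha_{MD}=\frac1m$ and $\gamma_i(MD)=\mathrm{Var}[\omega_i(S_{MD})]+\alpha_{MD}\,p_i^2$. **Statement.** For every clustered sampling (no assumption of the form $\mathrm{Cov}(\omega_i,\omega_j)=-\alpha p_ip_j$ is made): 1. *Statistics.* $\mathbb E[\omega_i(S_{Cl})]=p_i$. The quantity $A_{Cl}:=m\sum_i\big(\mathrm{Var}[\omega_i(S_{Cl})]+p_i^2\big)$ satisfies $$A_{Cl}=m\Big[\tfrac1m-\tfrac1{m^2}\sum_{i=1}^n\sum_{k=1}^m r_{k,i}^2+\sum_{i=1}^n p_i^2\Big]\ \le\ A_{MD}:=m\sum_i\big(\mathrm{Var}[\omega_i(S_{MD})]+p_i^2\big).$$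 Moreover $\mathrm{Cov}(\omega_i(S_{MD}),\omega_j(S_{MD}))=-\alpha_{MD}p_ip_j$ for $i\ne j$, and the MD-sampling quantities $D:=(K-1)\sum_i\gamma_i(MD)$ and $E:=K\sum_i\gamma_i(MD)$ equal $\frac1m(K-1)$ and $\frac1mK$. 2. *Jensen-type inequality.* For all $x_1,\dots,x_n\in\mathbb R^d$, $$\mathbb E\Big\|\sum_i\omega_i(S_{Cl})x_i\Big\|^2\le\sum_i\gamma_i(MD)\|x_i\|^2+(1-\alpha_{MD})\Big\|\sum_i p_ix_i\Big\|^2,$$ with equality if and only if $\sum_i r_{k,i}x_i=\sum_i r_{l,i}x_i$ for all $k,l\in\{1,\dots,m\}$. 3. *Convergence.* There are absolute constants $c,M>0$ such that, for FedAvg with clustered sampling, if the learning rates are so small that $$\beta^2\eta_l^2L^2K^2\le c,\qquad L\eta_g\eta_l(1-\alpha_{MD})K\le c,\qquad L\eta_g\eta_lK\Big(\sum_i\gamma_i(MD)\Big)\beta^2\le c,$$ then $\mathbb E\|\nabla\mathcal L(\theta^t)\|^2<\infty$ for all $t$, and for every $T\ge1$ $$\frac1T\sum_{t=0}^{T-1}\mathbb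 E\|\nabla\mathcal L(\theta^t)\|^2\le M\cdot\mathcal B(A_{Cl},D,E),$$ where, with $B=K-1$ and $C=K(K-1)$, $$\mathcal B(A,D,E)=\frac{\mathcal L(\theta^0)-\mathcal L(\theta^*)}{\eta_g\eta_lKT}+\frac{L\eta_g\eta_l}{m}A\sigma^2+L^2\eta_l^2B\sigma^2+L^2\eta_l^2C\kappa^2+L\eta_g\eta_lD\sigma^2+L\eta_g\eta_lE\kappa^2 .$$ Moreover the bound for clustered sampling is no worse than the one for MD sampling: $\mathcal B(A_{Cl},D,E)\le\mathcal B(A_{MD},D,E)$. -/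

import Mathlib

open MeasureTheory ProbabilityTheory
open scoped NNReal

noncomputable section

namespace FL

/-- The parameter space `ℝᵈ` with its Euclidean norm. -/
abbrev Model (d : ℕ) : Type := EuclideanSpace ℝ (Fin d)

/-! ### Client sampling -/

/-- The probability distribution on the `n` clients that gives mass `w i` to client `i`. -/
def categorical {n : ℕ} (w : Fin n → ℝ) : Measure (Fin n) :=
  ∑ i, ENNReal.ofReal (w i) • Measure.dirac i

/-- Law of the `m` sampled clients under clustered sampling: the `k`-th client is drawn from the
distribution `r k`, independently of the others. -/
def clusteredLaw {n m : ℕ} (r : Fin m → Fin n → ℝ) : Measure (Fin m → Fin n) :=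
  Measure.pi fun k => categorical (r k)

/-- Law of the `m` sampled clients under MD sampling: `m` i.i.d. draws with replacement from the
client importances `p`. -/
def mdLaw {n : ℕ} (m : ℕ) (p : Fin n → ℝ) : Measure (Fin m → Fin n) :=
  Measure.pi fun _ => categorical p

/-- Aggregation weight `ω_i(S)`: the proportion of the `m` draws that are equal to client `i`. -/
def aggWeight {n m : ℕ} (s : Fin m → Fin n) (i : Fin n) : ℝ :=
  ((Finset.univ.filter fun k => s k = i).card : ℝ) / m

/-- The sampling probabilities `r k i` (cluster `k`, client `i`) define a clustered sampling scheme
for the client importances `p`: every `r k` is a probability distribution on the clients, and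
`∑ₖ r k i = m pᵢ`. -/
structure IsClusteredScheme {n m : ℕ} (p : Fin n → ℝ) (r : Fin m → Fin n → ℝ) : Prop where
  nonneg : ∀ k i, 0 ≤ r k i
  sum_client : ∀ k, ∑ i, r k i = 1
  sum_cluster : ∀ i, ∑ k, r k i = m * p i

/-- `γ_i = Var[ω_i(S)] + α p_i²`, for sampled clients `S` of law `P`. -/
def gammaStat {n m : ℕ} (P : Measure (Fin m → Fin n)) (α : ℝ) (p : Fin n → ℝ) (i : Fin n) : ℝ :=
  variance (fun s => aggWeight s i) P + α * p i ^ 2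

/-- The covariance parameter of MD sampling. -/
def alphaMD (m : ℕ) : ℝ := 1 / m

/-! ### The quantities in the convergence bound -/

/-- `A = m ∑ᵢ (Var[ω_i(S)] + p_i²)`. -/
def coefA {n m : ℕ} (P : Measure (Fin m → Fin n)) (p : Fin n → ℝ) : ℝ :=
  m * ∑ i, (variance (fun s => aggWeight s i) P + p i ^ 2)

/-- `B = K - 1`. -/
def coefB (K : ℕ) : ℝ := (K : ℝ) - 1

/-- `C = K (K - 1)`. -/
def coefC (K : ℕ) : ℝ := (K : ℝ) * ((K : ℝ) - 1)

/-- `D = (K - 1) (∑ᵢ Var[ω_i(S)] + α ∑ᵢ p_i²)`. -/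
def coefD {n m : ℕ} (P : Measure (Fin m → Fin n)) (α : ℝ) (p : Fin n → ℝ) (K : ℕ) : ℝ :=
  ((K : ℝ) - 1) * ∑ i, gammaStat P α p i

/-- `E = K (∑ᵢ Var[ω_i(S)] + α ∑ᵢ p_i²)`. -/
def coefE {n m : ℕ} (P : Measure (Fin m → Fin n)) (α : ℝ) (p : Fin n → ℝ) (K : ℕ) : ℝ :=
  (K : ℝ) * ∑ i, gammaStat P α p i

/-- The convergence bound, up to an absolute constant, as a function of the sampling-dependent
quantities `A`, `D`, `E`. Here `gap` is the initial optimality gap, `L` the smoothness constant,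
`ηl`, `ηg` the local and global learning rates, `K` the number of local steps, `T` the number of
rounds, and `m` the number of sampled clients. -/
def convBound (gap L σ κ ηl ηg : ℝ) (K T m : ℕ) (A D E : ℝ) : ℝ :=
  gap / (ηg * ηl * K * T)
    + L * (ηg * ηl) * (1 / m) * A * σ ^ 2
    + L ^ 2 * ηl ^ 2 * coefB K * σ ^ 2
    + L ^ 2 * ηl ^ 2 * coefC K * κ ^ 2
    + L * (ηg * ηl) * D * σ ^ 2
    + L * (ηg * ηl) * E * κ ^ 2

/-! ### The optimization problem and FedAvg -/

/-- Federated loss `∑ᵢ pᵢ ℒᵢ`. -/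
def globalLoss {n d : ℕ} (p : Fin n → ℝ) (loss : Fin n → Model d → ℝ) (x : Model d) : ℝ :=
  ∑ i, p i * loss i x

/-- Local model of a client after `k` SGD steps with learning rate `ηl`, started at `θ`, where `g`
is the stochastic gradient of the client and `b k` is the batch used at the `k`-th step. -/
def localModel {d : ℕ} {Ξ : Type*} (g : Model d → Ξ → Model d) (ηl : ℝ) (θ : Model d)
    (b : ℕ → Ξ) : ℕ → Model d
  | 0 => θ
  | k + 1 => localModel g ηl θ b k - ηl • g (localModel g ηl θ b k) (b k)

/-- Global model of FedAvg after `t` rounds, started at `θ₀`, with `K` local steps per round, where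
`s t` are the clients sampled in round `t` and `b t i k` is the batch of client `i` at local step
`k` of round `t`. Clients that are not sampled have aggregation weight `0`. -/
def globalModel {n m d : ℕ} {Ξ : Type*} (g : Fin n → Model d → Ξ → Model d) (ηl ηg : ℝ) (K : ℕ)
    (θ₀ : Model d) (s : ℕ → Fin m → Fin n) (b : ℕ → Fin n → ℕ → Ξ) : ℕ → Model d
  | 0 => θ₀
  | t + 1 =>
    globalModel g ηl ηg K θ₀ s b t + ηg • ∑ i, aggWeight (s t) i •
      (localModel (g i) ηl (globalModel g ηl ηg K θ₀ s b t) (b t i) K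
        - globalModel g ηl ηg K θ₀ s b t)

/-- Smoothness: every local loss is differentiable with `L`-Lipschitz gradient. -/
def IsSmoothLoss {n d : ℕ} (loss : Fin n → Model d → ℝ) (L : ℝ≥0) : Prop :=
  ∀ i, Differentiable ℝ (loss i) ∧ LipschitzWith L (gradient (loss i))

/-- Bounded gradient dissimilarity with parameters `β² ≥ 1` and `κ²`. -/
def BoundedDissimilarity {n d : ℕ} (p : Fin n → ℝ) (loss : Fin n → Model d → ℝ) (β κ : ℝ) : Prop :=
  1 ≤ β ^ 2 ∧ ∀ x, ∑ i, p i * ‖gradient (loss i) x‖ ^ 2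
    ≤ β ^ 2 * ‖∑ i, p i • gradient (loss i) x‖ ^ 2 + κ ^ 2

/-- `g i x b` is the stochastic gradient of client `i` at `x` on the batch `b`. If `b` has law `ν i`,
it is an unbiased estimator of the gradient of the local loss, with variance at most `σ²`. -/
structure IsStochasticGradient {n d : ℕ} {Ξ : Type*} [MeasurableSpace Ξ]
    (loss : Fin n → Model d → ℝ) (ν : Fin n → Measure Ξ) (g : Fin n → Model d → Ξ → Model d)
    (σ : ℝ) : Prop where
  measurable : ∀ i, Measurable (Function.uncurry (g i))
  integrable : ∀ i x, Integrable (g i x) (ν i)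
  unbiased : ∀ i x, ∫ b, g i x b ∂(ν i) = gradient (loss i) x
  integrable_sq : ∀ i x, Integrable (fun b => ‖g i x b - gradient (loss i) x‖ ^ 2) (ν i)
  variance_le : ∀ i x, ∫ b, ‖g i x b - gradient (loss i) x‖ ^ 2 ∂(ν i) ≤ σ ^ 2

/-- The randomness of FedAvg: the samples `S t` of the rounds have law `P`, the batches `ξ t i k`
have law `ν i`, and all of these random variables are mutually independent. -/
structure IsFedAvgRandomness {n m : ℕ} {Ξ Ω : Type*} [MeasurableSpace Ξ] [MeasurableSpace Ω]
    (μ : Measure Ω) (P : Measure (Fin m → Fin n)) (ν : Fin n → Measure Ξ)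
    (S : ℕ → Ω → Fin m → Fin n) (ξ : ℕ → Fin n → ℕ → Ω → Ξ) : Prop where
  measurable_sample : ∀ t, Measurable (S t)
  measurable_batch : ∀ t i k, Measurable (ξ t i k)
  law_sample : ∀ t, HasLaw (S t) P μ
  law_batch : ∀ t i k, HasLaw (ξ t i k) (ν i) μ
  indep_sample : iIndepFun S μ
  indep_batch : iIndepFun (fun q : ℕ × Fin n × ℕ => ξ q.1 q.2.1 q.2.2) μ
  indep_sample_batch :
    IndepFun (fun w t => S t w) (fun w (q : ℕ × Fin n × ℕ) => ξ q.1 q.2.1 q.2.2 w) μ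

end FL

end

/-! The sampling statements all follow from one mixed moment,
`IsClusteredScheme.integral_aggWeight_mul`: independence of the draws gives `E[ω_i ω_j] = δ_ij p_i/m
+ p_i p_j - m⁻² ∑ₖ r_ki r_kj`. MD sampling is the case `r_k = p`, where `γ_i = p_i/m`.
Cauchy–Schwarz over the clusters compares `A_Cl` with `A_MD`. For vectors `x_i`, put `y_k = ∑ᵢ r_ki
x_i`; the mean of the `y_k` is `∑ᵢ p_i x_i`, and the gap in the Jensen-type inequality is exactly
their dispersion `(2m³)⁻¹ ∑ₖₗ ‖y_k - y_l‖²` (`IsClusteredScheme.jensen_gap`). Sign and equality case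
are read off from it, with no assumption on the covariances.

For convergence, the descent inequality for smooth functions is applied to one round with effective
step `a = ηg ηl`. The aggregated update splits into true gradients at the local iterates and
gradient noise. Each noise term is centred given everything but its own batch. So the noise drops
out of the linear term, and its second moment is at most `K σ² ∑ᵢ E[ω_i²] = K σ² A_Cl/m`; only here
do clustered statistics enter the bound. The gradient part is unbiased over the sampling, which
handles the linear term, and the Jensen-type inequality bounds its square with MD coefficients. A
discrete Gronwall argument (`local_drift_le`) controls how far the local iterates drift from the
global model. Small learning rates absorb the remaining multiples of `E‖∇ℒ‖²`
(`descent_of_moment_bounds`), and summing over the rounds telescopes. -/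

namespace FL

/-! ### Moments of the aggregation weights. -/

section Sampling

variable {n m : ℕ} {p : Fin n → ℝ} {r : Fin m → Fin n → ℝ}

lemma isProbabilityMeasure_categorical {w : Fin n → ℝ} (hw : ∀ i, 0 ≤ w i) (h1 : ∑ i, w i = 1) :
    IsProbabilityMeasure (categorical w) := by
  constructor
  simp [categorical, ← ENNReal.ofReal_sum_of_nonneg (fun i _ => hw i), h1]

lemma integral_categorical {w : Fin n → ℝ} (hw : ∀ i, 0 ≤ w i) (f : Fin n → ℝ) :
    ∫ i, f i ∂(categorical w) = ∑ i, w i * f i := by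
  rw [categorical, integral_finsetSum_measure]
  · refine Finset.sum_congr rfl fun i _ => ?_
    rw [integral_smul_measure, integral_dirac, ENNReal.toReal_ofReal (hw i), smul_eq_mul]
  · intro i _
    exact (integrable_dirac (by simp)).smul_measure ENNReal.ofReal_ne_top

lemma aggWeight_eq_sum (s : Fin m → Fin n) (i : Fin n) :
    aggWeight s i = (m : ℝ)⁻¹ * ∑ k, if s k = i then 1 else 0 := by
  rw [aggWeight, Finset.sum_boole, div_eq_inv_mul]

lemma aggWeight_nonneg (s : Fin m → Fin n) (i : Fin n) : 0 ≤ aggWeight s i := by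
  unfold aggWeight; positivity

lemma aggWeight_le_one (s : Fin m → Fin n) (i : Fin n) : aggWeight s i ≤ 1 := by
  unfold aggWeight
  refine div_le_one_of_le₀ ?_ (Nat.cast_nonneg _)
  exact_mod_cast (Finset.card_le_univ _).trans_eq (Fintype.card_fin m)

lemma IsClusteredScheme.isProbabilityMeasure_categorical (h : IsClusteredScheme p r) (k : Fin m) :
    IsProbabilityMeasure (categorical (r k)) :=
  FL.isProbabilityMeasure_categorical (h.nonneg k) (h.sum_client k)

lemma IsClusteredScheme.isProbabilityMeasure_clusteredLaw (h : IsClusteredScheme p r) :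
    IsProbabilityMeasure (clusteredLaw r) := by
  have := h.isProbabilityMeasure_categorical
  unfold clusteredLaw
  infer_instance

lemma IsClusteredScheme.importance_nonneg (h : IsClusteredScheme p r) (hm : 0 < m) (i : Fin n) :
    0 ≤ p i := by
  have h1 := h.sum_cluster i
  have h2 : 0 ≤ ∑ k, r k i := Finset.sum_nonneg fun k _ => h.nonneg k i
  rw [h1] at h2
  exact nonneg_of_mul_nonneg_right h2 (by exact_mod_cast hm)

lemma IsClusteredScheme.sum_importance (h : IsClusteredScheme p r) (hm : 0 < m) :
    ∑ i, p i = 1 := by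
  have hm' : (m : ℝ) ≠ 0 := by positivity
  have h1 : ∑ i, ∑ k, r k i = m * ∑ i, p i := by
    rw [Finset.mul_sum]
    exact Finset.sum_congr rfl fun i _ => h.sum_cluster i
  rw [Finset.sum_comm] at h1
  simp only [h.sum_client, Finset.sum_const, Finset.card_univ, Fintype.card_fin, nsmul_eq_mul,
    mul_one] at h1
  exact (mul_left_cancel₀ hm' (by linarith)).symm

lemma IsClusteredScheme.md (h : IsClusteredScheme p r) (hm : 0 < m) :
    IsClusteredScheme p (fun _ : Fin m => p) where
  nonneg _ := h.importance_nonneg hm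
  sum_client _ := h.sum_importance hm
  sum_cluster i := by simp

lemma mdLaw_eq_clusteredLaw (m : ℕ) (p : Fin n → ℝ) :
    mdLaw m p = clusteredLaw (fun _ : Fin m => p) := rfl

lemma IsClusteredScheme.integral_draw (h : IsClusteredScheme p r) (k : Fin m) (f : Fin n → ℝ) :
    ∫ s, f (s k) ∂(clusteredLaw r) = ∑ i, r k i * f i := by
  have := h.isProbabilityMeasure_categorical
  rw [← integral_categorical (h.nonneg k)]
  exact integral_comp_eval (μ := fun k => categorical (r k))
    (measurable_of_finite f).aestronglyMeasurable

lemma IsClusteredScheme.integral_draw_mul (h : IsClusteredScheme p r) {k l : Fin m} (hkl : k ≠ l)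
    (f g : Fin n → ℝ) :
    ∫ s, f (s k) * g (s l) ∂(clusteredLaw r)
      = (∑ i, r k i * f i) * ∑ i, r l i * g i := by
  have := h.isProbabilityMeasure_categorical
  have hind : iIndepFun (fun k (s : Fin m → Fin n) => s k) (clusteredLaw r) :=
    iIndepFun_pi (X := fun _ x => x) fun _ => aemeasurable_id
  rw [← h.integral_draw k f, ← h.integral_draw l g]
  exact ((hind.indepFun hkl).comp (measurable_of_finite f)
    (measurable_of_finite g)).integral_fun_mul_eq_mul_integral
    (measurable_of_finite _).aestronglyMeasurable (measurable_of_finite _).aestronglyMeasurable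

lemma IsClusteredScheme.integral_aggWeight (h : IsClusteredScheme p r) (hm : 0 < m) (i : Fin n) :
    ∫ s, aggWeight s i ∂(clusteredLaw r) = p i := by
  have := h.isProbabilityMeasure_clusteredLaw
  have hm' : (m : ℝ) ≠ 0 := by positivity
  simp_rw [aggWeight_eq_sum]
  rw [integral_const_mul, integral_finsetSum _ fun _ _ => .of_finite]
  simp_rw [fun k => h.integral_draw k (fun a => if a = i then 1 else 0)]
  simp [h.sum_cluster, hm']

/-- Expand over pairs of draws: distinct draws factor by independence. Completing the double sum
with its diagonal yields `p_i p_j` and leaves a diagonal correction. -/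
lemma IsClusteredScheme.integral_aggWeight_mul (h : IsClusteredScheme p r) (hm : 0 < m)
    (i j : Fin n) :
    ∫ s, aggWeight s i * aggWeight s j ∂(clusteredLaw r)
      = (if i = j then p i else 0) / m + p i * p j - 1 / (m : ℝ) ^ 2 * ∑ k, r k i * r k j := by
  have := h.isProbabilityMeasure_clusteredLaw
  have hm' : (m : ℝ) ≠ 0 := by positivity
  -- The product form is written for all pairs, so that the sum over `k, l` factors; the second
  -- summand corrects the diagonal `k = l`.
  have key : ∀ k l : Fin m, ∫ s, (if s k = i then (1 : ℝ) else 0) * (if s l = j then 1 else 0)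
      ∂(clusteredLaw r) = r k i * r l j +
        if k = l then (if i = j then r k i else 0) - r k i * r k j else 0 := by
    intro k l
    rcases eq_or_ne k l with rfl | hkl
    · have := h.integral_draw k (fun a => (if a = i then (1 : ℝ) else 0) * (if a = j then 1 else 0))
      rw [this]
      simp only [mul_ite, mul_one, mul_zero, ← ite_and, if_true]
      rcases eq_or_ne i j with rfl | hij
      · simp
      · rw [if_neg hij, Finset.sum_eq_zero]
        · ring
        · rintro a -
          exact if_neg fun h => hij (h.2.symm.trans h.1)
    · have := h.integral_draw_mul hkl (fun a => if a = i then (1 : ℝ) else 0)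
        (fun a => if a = j then (1 : ℝ) else 0)
      rw [this, if_neg hkl]
      simp
  have e : ∀ s : Fin m → Fin n, aggWeight s i * aggWeight s j = ((m : ℝ) ^ 2)⁻¹ *
      ∑ k, ∑ l, (if s k = i then (1 : ℝ) else 0) * (if s l = j then 1 else 0) := by
    intro s
    rw [aggWeight_eq_sum, aggWeight_eq_sum, ← Finset.sum_mul_sum]
    ring
  simp_rw [e]
  rw [integral_const_mul, integral_finsetSum _ fun _ _ => .of_finite]
  simp_rw [integral_finsetSum (μ := clusteredLaw r) Finset.univ fun _ _ => .of_finite, key,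
    Finset.sum_add_distrib, Finset.sum_ite_eq, Finset.mem_univ, if_true, ← Finset.sum_mul_sum,
    h.sum_cluster, Finset.sum_sub_distrib]
  have : ∑ k, (if i = j then r k i else 0) = m * if i = j then p i else 0 := by
    split_ifs
    · exact h.sum_cluster i
    · simp
  rw [this]
  field_simp
  ring

lemma IsClusteredScheme.covariance_aggWeight (h : IsClusteredScheme p r) (hm : 0 < m)
    (i j : Fin n) :
    covariance (fun s => aggWeight s i) (fun s => aggWeight s j) (clusteredLaw r)
      = (if i = j then p i else 0) / m - 1 / (m : ℝ) ^ 2 * ∑ k, r k i * r k j := by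
  have := h.isProbabilityMeasure_clusteredLaw
  rw [covariance_eq_sub .of_discrete .of_discrete]
  simp only [Pi.mul_apply]
  rw [h.integral_aggWeight_mul hm, h.integral_aggWeight hm, h.integral_aggWeight hm]
  ring

lemma IsClusteredScheme.variance_aggWeight (h : IsClusteredScheme p r) (hm : 0 < m) (i : Fin n) :
    variance (fun s => aggWeight s i) (clusteredLaw r)
      = p i / m - 1 / (m : ℝ) ^ 2 * ∑ k, r k i ^ 2 := by
  rw [← covariance_self (measurable_of_finite _).aemeasurable, h.covariance_aggWeight hm]
  simp [sq]

lemma IsClusteredScheme.coefA_eq (h : IsClusteredScheme p r) (hm : 0 < m) :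
    coefA (clusteredLaw r) p
      = m * (1 / m - 1 / (m : ℝ) ^ 2 * ∑ i, ∑ k, r k i ^ 2 + ∑ i, p i ^ 2) := by
  simp_rw [coefA, h.variance_aggWeight hm, Finset.sum_add_distrib, Finset.sum_sub_distrib,
    ← Finset.mul_sum, ← Finset.sum_div, h.sum_importance hm]

/-- Cauchy–Schwarz over the clusters. Since `∑ₖ r_ki²` enters the variance with a minus sign, this
is why clustering never increases it. -/
lemma IsClusteredScheme.sq_importance_le (h : IsClusteredScheme p r) (hm : 0 < m) (i : Fin n) :
    m * p i ^ 2 ≤ ∑ k, r k i ^ 2 := by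
  have h1 := sq_sum_le_card_mul_sum_sq (s := Finset.univ) (f := fun k => r k i)
  rw [h.sum_cluster, Finset.card_univ, Fintype.card_fin] at h1
  have hm' : (0 : ℝ) < m := by exact_mod_cast hm
  nlinarith

lemma IsClusteredScheme.coefA_le (h : IsClusteredScheme p r) (hm : 0 < m) :
    coefA (clusteredLaw r) p ≤ coefA (mdLaw m p) p := by
  rw [mdLaw_eq_clusteredLaw]
  unfold coefA
  gcongr with i
  rw [h.variance_aggWeight hm, (h.md hm).variance_aggWeight hm]
  have := h.sq_importance_le hm i
  simp only [Finset.sum_const, Finset.card_univ, Fintype.card_fin, nsmul_eq_mul]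
  gcongr

lemma IsClusteredScheme.covariance_md (h : IsClusteredScheme p r) (hm : 0 < m) {i j : Fin n}
    (hij : i ≠ j) :
    covariance (fun s => aggWeight s i) (fun s => aggWeight s j) (mdLaw m p)
      = -(alphaMD m) * p i * p j := by
  rw [mdLaw_eq_clusteredLaw, (h.md hm).covariance_aggWeight hm, if_neg hij, alphaMD]
  have hm' : (m : ℝ) ≠ 0 := by positivity
  simp
  field_simp

lemma IsClusteredScheme.gammaStat_md (h : IsClusteredScheme p r) (hm : 0 < m) (i : Fin n) :
    gammaStat (mdLaw m p) (alphaMD m) p i = p i / m := by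
  rw [gammaStat, mdLaw_eq_clusteredLaw, (h.md hm).variance_aggWeight hm, alphaMD]
  have hm' : (m : ℝ) ≠ 0 := by positivity
  simp
  field_simp
  ring

lemma IsClusteredScheme.sum_gammaStat_md (h : IsClusteredScheme p r) (hm : 0 < m) :
    ∑ i, gammaStat (mdLaw m p) (alphaMD m) p i = 1 / m := by
  simp_rw [h.gammaStat_md hm, ← Finset.sum_div, h.sum_importance hm]

end Sampling

/-! ### The Jensen-type inequality and its equality case. -/

section Jensen

variable {n m : ℕ} {p : Fin n → ℝ} {r : Fin m → Fin n → ℝ}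
  {E : Type*} [NormedAddCommGroup E] [InnerProductSpace ℝ E]

lemma norm_sq_sum_smul (w : Fin n → ℝ) (x : Fin n → E) :
    ‖∑ i, w i • x i‖ ^ 2 = ∑ i, ∑ j, w i * w j * inner ℝ (x i) (x j) := by
  rw [← real_inner_self_eq_norm_sq, sum_inner]
  simp_rw [inner_sum, real_inner_smul_left, real_inner_smul_right, mul_assoc]

lemma IsClusteredScheme.integral_norm_sq (h : IsClusteredScheme p r) (hm : 0 < m) (x : Fin n → E) :
    ∫ s, ‖∑ i, aggWeight s i • x i‖ ^ 2 ∂(clusteredLaw r)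
      = ∑ i, p i / m * ‖x i‖ ^ 2 + ‖∑ i, p i • x i‖ ^ 2
        - 1 / (m : ℝ) ^ 2 * ∑ k, ‖∑ i, r k i • x i‖ ^ 2 := by
  have := h.isProbabilityMeasure_clusteredLaw
  simp_rw [norm_sq_sum_smul]
  rw [integral_finsetSum _ fun _ _ => .of_finite]
  simp_rw [integral_finsetSum (μ := clusteredLaw r) Finset.univ fun _ _ => .of_finite,
    integral_mul_const, h.integral_aggWeight_mul hm, sub_mul, add_mul, Finset.sum_sub_distrib,
    Finset.sum_add_distrib]
  congr 1
  · congr 1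
    refine Finset.sum_congr rfl fun i _ => ?_
    simp [ite_div, ite_mul]
  · simp_rw [Finset.mul_sum, Finset.sum_mul]
    conv_rhs => rw [Finset.sum_comm]
    refine Finset.sum_congr rfl fun i _ => ?_
    rw [Finset.sum_comm]
    simp_rw [mul_assoc]

lemma sum_norm_sub_sq_eq (y : Fin m → E) :
    ∑ k, ∑ l, ‖y k - y l‖ ^ 2 = 2 * (m * ∑ k, ‖y k‖ ^ 2 - ‖∑ k, y k‖ ^ 2) := by
  have e : ‖∑ k, y k‖ ^ 2 = ∑ k, ∑ l, inner ℝ (y k) (y l) := by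
    rw [← real_inner_self_eq_norm_sq, sum_inner]
    simp_rw [inner_sum]
  rw [e]
  simp_rw [norm_sub_sq_real, Finset.sum_add_distrib, Finset.sum_sub_distrib, ← Finset.mul_sum]
  simp
  rw [← Finset.mul_sum]
  ring

/-- The terms in `‖x_i‖²` cancel because `γ_i = p_i/m`; what remains is the variance identity for
the cluster means `∑ᵢ r_ki x_i`, whose sum over `k` is `m ∑ᵢ p_i x_i`. -/
lemma IsClusteredScheme.jensen_gap (h : IsClusteredScheme p r) (hm : 0 < m) (x : Fin n → E) :
    (∑ i, gammaStat (mdLaw m p) (alphaMD m) p i * ‖x i‖ ^ 2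
        + (1 - alphaMD m) * ‖∑ i, p i • x i‖ ^ 2)
      - ∫ s, ‖∑ i, aggWeight s i • x i‖ ^ 2 ∂(clusteredLaw r)
      = 1 / (2 * (m : ℝ) ^ 3) * ∑ k, ∑ l, ‖∑ i, r k i • x i - ∑ i, r l i • x i‖ ^ 2 := by
  have hm' : (m : ℝ) ≠ 0 := by positivity
  have e : ∑ k, ∑ i, r k i • x i = (m : ℝ) • ∑ i, p i • x i := by
    rw [Finset.sum_comm, Finset.smul_sum]
    refine Finset.sum_congr rfl fun i _ => ?_
    rw [← Finset.sum_smul, h.sum_cluster, mul_smul]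
  rw [sum_norm_sub_sq_eq, e, norm_smul, mul_pow, h.integral_norm_sq hm]
  simp_rw [h.gammaStat_md hm]
  simp only [alphaMD, Real.norm_natCast]
  field_simp
  ring

lemma IsClusteredScheme.jensen_le (h : IsClusteredScheme p r) (hm : 0 < m) (x : Fin n → E) :
    ∫ s, ‖∑ i, aggWeight s i • x i‖ ^ 2 ∂(clusteredLaw r)
      ≤ ∑ i, gammaStat (mdLaw m p) (alphaMD m) p i * ‖x i‖ ^ 2
        + (1 - alphaMD m) * ‖∑ i, p i • x i‖ ^ 2 := by
  rw [← sub_nonneg, h.jensen_gap hm]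
  positivity

lemma IsClusteredScheme.jensen_eq_iff (h : IsClusteredScheme p r) (hm : 0 < m) (x : Fin n → E) :
    ∫ s, ‖∑ i, aggWeight s i • x i‖ ^ 2 ∂(clusteredLaw r)
      = ∑ i, gammaStat (mdLaw m p) (alphaMD m) p i * ‖x i‖ ^ 2
        + (1 - alphaMD m) * ‖∑ i, p i • x i‖ ^ 2
      ↔ ∀ k l, ∑ i, r k i • x i = ∑ i, r l i • x i := by
  have hm' : (m : ℝ) ≠ 0 := by positivity
  rw [eq_comm, ← sub_eq_zero, h.jensen_gap hm, mul_eq_zero,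
    Finset.sum_eq_zero_iff_of_nonneg fun _ _ => by positivity]
  have e : ∀ k, ∑ l, ‖∑ i, r k i • x i - ∑ i, r l i • x i‖ ^ 2 = 0
      ↔ ∀ l, ∑ i, r k i • x i = ∑ i, r l i • x i := fun k => by
    rw [Finset.sum_eq_zero_iff_of_nonneg fun _ _ => by positivity]
    simp [sub_eq_zero]
  simp [hm', e]

end Jensen

/-! ### Gradient of the federated loss. -/

section Smooth

variable {n d : ℕ} {p : Fin n → ℝ} {loss : Fin n → Model d → ℝ} {L : ℝ≥0}

lemma IsSmoothLoss.hasGradientAt_globalLoss (h : IsSmoothLoss loss L) (p : Fin n → ℝ)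
    (x : Model d) :
    HasGradientAt (globalLoss p loss) (∑ i, p i • gradient (loss i) x) x := by
  rw [hasGradientAt_iff_hasFDerivAt, map_sum]
  have : globalLoss p loss = fun x => ∑ i, p i * loss i x := rfl
  rw [this]
  refine HasFDerivAt.fun_sum fun i _ => ?_
  rw [map_smul]
  exact (((h i).1 x).hasGradientAt.hasFDerivAt).const_mul (p i)

lemma IsSmoothLoss.gradient_globalLoss (h : IsSmoothLoss loss L) (p : Fin n → ℝ) (x : Model d) :
    gradient (globalLoss p loss) x = ∑ i, p i • gradient (loss i) x :=
  (h.hasGradientAt_globalLoss p x).gradient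

lemma IsSmoothLoss.differentiable_globalLoss (h : IsSmoothLoss loss L) (p : Fin n → ℝ) :
    Differentiable ℝ (globalLoss p loss) :=
  fun x => (h.hasGradientAt_globalLoss p x).differentiableAt

lemma IsSmoothLoss.lipschitzWith_gradient_globalLoss (h : IsSmoothLoss loss L)
    (hp : ∀ i, 0 ≤ p i) (h1 : ∑ i, p i = 1) :
    LipschitzWith L (gradient (globalLoss p loss)) := by
  refine LipschitzWith.of_dist_le_mul fun x y => ?_
  rw [dist_eq_norm, h.gradient_globalLoss, h.gradient_globalLoss, ← Finset.sum_sub_distrib]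
  calc ‖∑ i, (p i • gradient (loss i) x - p i • gradient (loss i) y)‖
      ≤ ∑ i, ‖p i • gradient (loss i) x - p i • gradient (loss i) y‖ := norm_sum_le _ _
    _ ≤ ∑ i, p i * (L * dist x y) := by
        gcongr with i
        rw [← smul_sub, norm_smul, Real.norm_of_nonneg (hp i), ← dist_eq_norm]
        exact mul_le_mul_of_nonneg_left ((h i).2.dist_le_mul x y) (hp i)
    _ = L * dist x y := by rw [← Finset.sum_mul, h1, one_mul]

end Smooth

/-! ### The descent inequality for smooth functions. -/

section Descent

variable {E : Type*} [NormedAddCommGroup E] [InnerProductSpace ℝ E] [CompleteSpace E]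

lemma le_quadratic_of_lipschitzWith_gradient {f : E → ℝ} {L : ℝ≥0} (hf : Differentiable ℝ f)
    (hL : LipschitzWith L (gradient f)) (x v : E) :
    f (x + v) ≤ f x + inner ℝ (gradient f x) v + L / 2 * ‖v‖ ^ 2 := by
  -- The claim is `ψ 1 ≤ ψ 0`; the Lipschitz bound on the gradient makes `ψ' ≤ 0` on `(0, 1)`.
  let ψ : ℝ → ℝ := fun s => f (x + s • v) - s * inner ℝ (gradient f x) v - L / 2 * s ^ 2 * ‖v‖ ^ 2
  have hψ : ∀ s, HasDerivAt ψ (inner ℝ (gradient f (x + s • v)) v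
      - inner ℝ (gradient f x) v - L * s * ‖v‖ ^ 2) s := by
    intro s
    have h1 : HasDerivAt (fun s : ℝ => x + s • v) v s := by
      simpa using ((hasDerivAt_id s).smul_const v).const_add x
    have h2 := (hf (x + s • v)).hasGradientAt.hasFDerivAt.comp_hasDerivAt s h1
    have h3 := (hasDerivAt_id s).mul_const (inner ℝ (gradient f x) v)
    have h4 := (((hasDerivAt_id s).pow 2).const_mul ((L : ℝ) / 2)).mul_const (‖v‖ ^ 2)
    refine ((h2.sub h3).sub h4).congr_deriv ?_
    rw [InnerProductSpace.toDual_apply_apply]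
    simp only [id, Nat.cast_ofNat]
    ring
  have hanti : AntitoneOn ψ (Set.Icc 0 1) := by
    refine antitoneOn_of_deriv_nonpos (convex_Icc 0 1)
      (fun s _ => (hψ s).continuousAt.continuousWithinAt)
      (fun s _ => (hψ s).differentiableAt.differentiableWithinAt) fun s hs => ?_
    rw [interior_Icc] at hs
    rw [(hψ s).deriv, ← inner_sub_left]
    have h1 := real_inner_le_norm (gradient f (x + s • v) - gradient f x) v
    have h2 := hL.dist_le_mul (x + s • v) x
    rw [dist_eq_norm, dist_eq_norm, add_sub_cancel_left, norm_smul,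
      Real.norm_of_nonneg hs.1.le] at h2
    nlinarith [mul_le_mul_of_nonneg_right h2 (norm_nonneg v)]
  have := hanti (Set.left_mem_Icc.2 zero_le_one) (Set.right_mem_Icc.2 zero_le_one) zero_le_one
  simp only [ψ, one_smul, zero_smul, add_zero] at this
  linarith

end Descent

/-! ### Norm inequalities, square integrability and orthogonality. -/

section Norms

variable {Ω : Type*} [MeasurableSpace Ω] {μ : Measure Ω} {E : Type*} [NormedAddCommGroup E]

lemma norm_sum_sq_le {ι : Type*} (s : Finset ι) (x : ι → E) :
    ‖∑ a ∈ s, x a‖ ^ 2 ≤ s.card * ∑ a ∈ s, ‖x a‖ ^ 2 :=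
  (pow_le_pow_left₀ (norm_nonneg _) (norm_sum_le s x) 2).trans sq_sum_le_card_mul_sum_sq

lemma integrable_norm_sq_of_memLp {X : Ω → E} (hX : MemLp X 2 μ) :
    Integrable (fun w => ‖X w‖ ^ 2) μ := hX.integrable_norm_pow (by norm_num)

lemma memLp_comp_of_lipschitzWith {F : Type*} [NormedAddCommGroup F]
    [IsFiniteMeasure μ] {f : E → F} {L : ℝ≥0}
    (hf : LipschitzWith L f) {X : Ω → E} (hX : MemLp X 2 μ) :
    MemLp (fun w => f (X w)) 2 μ := by
  refine MemLp.of_le (((hX.norm.const_mul (L : ℝ))).add (memLp_const ‖f 0‖))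
    (hf.continuous.comp_aestronglyMeasurable hX.1) (ae_of_all _ fun w => ?_)
  have h1 := hf.dist_le_mul (X w) 0
  rw [dist_eq_norm, dist_eq_norm, sub_zero] at h1
  have h2 := norm_sub_norm_le (f (X w)) (f 0)
  refine le_trans ?_ (le_abs_self _)
  simp only [Pi.add_apply]
  linarith

end Norms

section SecondMoments

variable {Ω : Type*} [MeasurableSpace Ω] {μ : Measure Ω}
  {E : Type*} [NormedAddCommGroup E] [InnerProductSpace ℝ E]

lemma norm_add_sq_le (x y : E) : ‖x + y‖ ^ 2 ≤ 2 * ‖x‖ ^ 2 + 2 * ‖y‖ ^ 2 := by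
  have := parallelogram_law_with_norm ℝ x y
  nlinarith [mul_self_nonneg ‖x - y‖]

lemma norm_sum_smul_sq_le {ι : Type*} (s : Finset ι) {p : ι → ℝ} (hp : ∀ i ∈ s, 0 ≤ p i)
    (h1 : ∑ i ∈ s, p i = 1) (x : ι → E) :
    ‖∑ i ∈ s, p i • x i‖ ^ 2 ≤ ∑ i ∈ s, p i * ‖x i‖ ^ 2 := by
  have := (convexOn_univ_norm (E := E)).pow (fun _ _ => norm_nonneg _) 2
  simpa using this.map_sum_le hp h1 fun i _ => Set.mem_univ (x i)

lemma integrable_inner_of_memLp {X Y : Ω → E} (hX : MemLp X 2 μ) (hY : MemLp Y 2 μ) :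
    Integrable (fun w => inner ℝ (X w) (Y w)) μ := by
  refine Integrable.mono' (hX.norm.integrable_mul hY.norm)
    (hX.1.inner hY.1) (ae_of_all _ fun w => ?_)
  exact norm_inner_le_norm _ _

lemma integral_norm_sum_sq_of_orthogonal {ι : Type*} (s : Finset ι) {f : ι → Ω → E}
    (hf : ∀ a ∈ s, MemLp (f a) 2 μ)
    (h : ∀ a ∈ s, ∀ b ∈ s, a ≠ b → ∫ w, inner ℝ (f a w) (f b w) ∂μ = 0) :
    ∫ w, ‖∑ a ∈ s, f a w‖ ^ 2 ∂μ = ∑ a ∈ s, ∫ w, ‖f a w‖ ^ 2 ∂μ := by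
  simp_rw [← real_inner_self_eq_norm_sq, sum_inner, inner_sum]
  rw [integral_finsetSum]
  · refine Finset.sum_congr rfl fun a ha => ?_
    rw [integral_finsetSum _ fun b hb => integrable_inner_of_memLp (hf a ha) (hf b hb)]
    exact Finset.sum_eq_single_of_mem a ha fun b hb hba => h a ha b hb hba.symm
  · exact fun a ha => integrable_finsetSum _ fun b hb =>
      integrable_inner_of_memLp (hf a ha) (hf b hb)

/-- The minimum bounds `f` from below and the descent inequality at `0` bounds it above by a
quadratic, so square integrability of `X` suffices. -/
lemma integrable_comp_of_quadratic [IsFiniteMeasure μ] [CompleteSpace E] {f : E → ℝ} {L : ℝ≥0}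
    (hf : Differentiable ℝ f) (hL : LipschitzWith L (gradient f)) {x₀ : E}
    (hmin : ∀ x, f x₀ ≤ f x) {X : Ω → E} (hX : MemLp X 2 μ) :
    Integrable (fun w => f (X w)) μ := by
  have hup : Integrable (fun w => |f x₀| + (|f 0| + ‖gradient f 0‖ * ‖X w‖ + L / 2 *
      ‖X w‖ ^ 2)) μ :=
    (integrable_const _).add (((integrable_const _).add
      ((hX.norm.integrable (by norm_num)).const_mul _)).add
      ((integrable_norm_sq_of_memLp hX).const_mul _))
  refine hup.mono' (hf.continuous.comp_aestronglyMeasurable hX.1) (ae_of_all _ fun w => ?_)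
  have h1 := le_quadratic_of_lipschitzWith_gradient hf hL 0 (X w)
  rw [zero_add] at h1
  have h2 := real_inner_le_norm (gradient f 0) (X w)
  have h3 := hmin (X w)
  have h4 : 0 ≤ ‖gradient f 0‖ * ‖X w‖ + L / 2 * ‖X w‖ ^ 2 := by positivity
  rw [Real.norm_eq_abs, abs_le]
  constructor <;> linarith [neg_abs_le (f x₀), le_abs_self (f 0), abs_nonneg (f 0),
      abs_nonneg (f x₀)]

end SecondMoments

/-! ### Noise that is centred once the past is frozen. -/

section Noise

variable {Ω Ξ E : Type*} [MeasurableSpace Ω] [MeasurableSpace Ξ] {μ : Measure Ω}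
  [IsProbabilityMeasure μ] {ν : Measure Ξ} [IsProbabilityMeasure ν]
  [NormedAddCommGroup E] [MeasurableSpace E] [BorelSpace E]

/-- Independence makes the joint law a product, so the batch can be integrated first with `X` and
`W` frozen. The weight allows for `ω_i²`; lower integrals avoid assuming the integrability that
`memLp_noise` deduces from `W = 1`. -/
lemma lintegral_weighted_noise_le {N : E → Ξ → E} (hN : Measurable (Function.uncurry N)) {σ : ℝ}
    (hint : ∀ x, Integrable (fun b => ‖N x b‖ ^ 2) ν) (hσ : ∀ x, ∫ b, ‖N x b‖ ^ 2 ∂ν ≤ σ ^ 2)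
    {X : Ω → E} {W : Ω → ℝ} {Y : Ω → Ξ} (hX : Measurable X) (hW : Measurable W)
    (hY : Measurable Y) (hlaw : HasLaw Y ν μ) (hW0 : ∀ w, 0 ≤ W w)
    (hind : IndepFun (fun w => (X w, W w)) Y μ) :
    ∫⁻ w, ENNReal.ofReal (W w * ‖N (X w) (Y w)‖ ^ 2) ∂μ
      ≤ ENNReal.ofReal (σ ^ 2) * ∫⁻ w, ENNReal.ofReal (W w) ∂μ := by
  have hXW : Measurable fun w => (X w, W w) := hX.prodMk hW
  have hmap := (indepFun_iff_map_prod_eq_prod_map_map hXW.aemeasurable hY.aemeasurable).1 hind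
  rw [hlaw.map_eq] at hmap
  have hF : Measurable fun z : (E × ℝ) × Ξ => ‖N z.1.1 z.2‖ ^ 2 :=
    (hN.comp ((measurable_fst.fst).prodMk measurable_snd)).norm.pow_const 2
  have hG : Measurable fun z : (E × ℝ) × Ξ => ENNReal.ofReal (z.1.2 * ‖N z.1.1 z.2‖ ^ 2) :=
    ((measurable_fst.snd).mul hF).ennreal_ofReal
  calc ∫⁻ w, ENNReal.ofReal (W w * ‖N (X w) (Y w)‖ ^ 2) ∂μ
      = ∫⁻ z, ENNReal.ofReal (z.1.2 * ‖N z.1.1 z.2‖ ^ 2) ∂(μ.map fun w => ((X w, W w), Y w)) := by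
        rw [lintegral_map hG (hXW.prodMk hY)]
    _ = ∫⁻ u, ∫⁻ b, ENNReal.ofReal (u.2 * ‖N u.1 b‖ ^ 2) ∂ν ∂(μ.map fun w => (X w, W w)) := by
        rw [hmap, lintegral_prod _ hG.aemeasurable]
    _ = ∫⁻ w, ∫⁻ b, ENNReal.ofReal (W w * ‖N (X w) b‖ ^ 2) ∂ν ∂μ :=
        lintegral_map hG.lintegral_prod_right' hXW
    _ ≤ ∫⁻ w, ENNReal.ofReal (σ ^ 2) * ENNReal.ofReal (W w) ∂μ := by
        refine lintegral_mono fun w => ?_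
        simp_rw [ENNReal.ofReal_mul (hW0 w)]
        rw [lintegral_const_mul' _ _ ENNReal.ofReal_ne_top, mul_comm,
          ← ofReal_integral_eq_lintegral_ofReal (hint _) (ae_of_all _ fun _ => by positivity)]
        gcongr
        exact hσ _
    _ = _ := lintegral_const_mul _ hW.ennreal_ofReal

lemma integral_weighted_noise_le {N : E → Ξ → E} (hN : Measurable (Function.uncurry N)) {σ : ℝ}
    (hint : ∀ x, Integrable (fun b => ‖N x b‖ ^ 2) ν) (hσ : ∀ x, ∫ b, ‖N x b‖ ^ 2 ∂ν ≤ σ ^ 2)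
    {X : Ω → E} {W : Ω → ℝ} {Y : Ω → Ξ} (hX : Measurable X) (hW : Measurable W)
    (hY : Measurable Y) (hlaw : HasLaw Y ν μ) (hW0 : ∀ w, 0 ≤ W w) (hWint : Integrable W μ)
    (hind : IndepFun (fun w => (X w, W w)) Y μ) :
    ∫ w, W w * ‖N (X w) (Y w)‖ ^ 2 ∂μ ≤ σ ^ 2 * ∫ w, W w ∂μ := by
  have hm : Measurable fun w => W w * ‖N (X w) (Y w)‖ ^ 2 :=
    hW.mul ((hN.comp (hX.prodMk hY)).norm.pow_const 2)
  rw [integral_eq_lintegral_of_nonneg_ae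
    (ae_of_all _ fun w => mul_nonneg (hW0 w) (sq_nonneg _)) hm.aestronglyMeasurable]
  refine ENNReal.toReal_le_of_le_ofReal (mul_nonneg (sq_nonneg _) (integral_nonneg hW0)) ?_
  rw [ENNReal.ofReal_mul (sq_nonneg _),
    ofReal_integral_eq_lintegral_ofReal hWint (ae_of_all _ hW0)]
  exact lintegral_weighted_noise_le hN hint hσ hX hW hY hlaw hW0 hind

lemma memLp_noise [SecondCountableTopology E] {N : E → Ξ → E}
    (hN : Measurable (Function.uncurry N)) {σ : ℝ}
    (hint : ∀ x, Integrable (fun b => ‖N x b‖ ^ 2) ν) (hσ : ∀ x, ∫ b, ‖N x b‖ ^ 2 ∂ν ≤ σ ^ 2)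
    {X : Ω → E} {Y : Ω → Ξ} (hX : Measurable X) (hY : Measurable Y) (hlaw : HasLaw Y ν μ)
    (hind : IndepFun X Y μ) :
    MemLp (fun w => N (X w) (Y w)) 2 μ := by
  have hm : Measurable fun w => N (X w) (Y w) := hN.comp (hX.prodMk hY)
  rw [memLp_two_iff_integrable_sq_norm hm.aestronglyMeasurable]
  refine ⟨(hm.norm.pow_const 2).aestronglyMeasurable, ?_⟩
  rw [hasFiniteIntegral_iff_ofReal (ae_of_all _ fun _ => sq_nonneg _)]
  have := lintegral_weighted_noise_le hN hint hσ hX (W := fun _ => 1) measurable_const hY hlaw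
    (fun _ => zero_le_one) (hind.comp (φ := fun x => (x, (1 : ℝ))) (by fun_prop) measurable_id)
  simp only [one_mul, ENNReal.ofReal_one, lintegral_const, measure_univ, mul_one] at this
  exact this.trans_lt ENNReal.ofReal_lt_top

/-- Fubini again: with `(X, Z)` frozen, the inner integral over the batch is `⟨Z, 0⟩`. -/
lemma integral_inner_noise_eq_zero [InnerProductSpace ℝ E] [SecondCountableTopology E]
    [CompleteSpace E] {N : E → Ξ → E} (hN : Measurable (Function.uncurry N))
    (hint : ∀ x, Integrable (N x) ν) (h0 : ∀ x, ∫ b, N x b ∂ν = 0)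
    {X Z : Ω → E} {Y : Ω → Ξ} (hX : Measurable X) (hZ : Measurable Z)
    (hY : Measurable Y) (hlaw : HasLaw Y ν μ) (hind : IndepFun (fun w => (X w, Z w)) Y μ)
    (hZ2 : MemLp Z 2 μ) (hN2 : MemLp (fun w => N (X w) (Y w)) 2 μ) :
    ∫ w, inner ℝ (Z w) (N (X w) (Y w)) ∂μ = 0 := by
  have hXZ : Measurable fun w => (X w, Z w) := hX.prodMk hZ
  have hmap := (indepFun_iff_map_prod_eq_prod_map_map hXZ.aemeasurable hY.aemeasurable).1 hind
  rw [hlaw.map_eq] at hmap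
  have hF : Measurable fun z : (E × E) × Ξ => inner ℝ z.1.2 (N z.1.1 z.2) :=
    (measurable_fst.snd).inner (hN.comp ((measurable_fst.fst).prodMk measurable_snd))
  have hi : Integrable (fun z : (E × E) × Ξ => inner ℝ z.1.2 (N z.1.1 z.2))
      ((μ.map fun w => (X w, Z w)).prod ν) := by
    rw [← hmap, integrable_map_measure hF.aestronglyMeasurable (hXZ.prodMk hY).aemeasurable]
    exact integrable_inner_of_memLp hZ2 hN2
  calc ∫ w, inner ℝ (Z w) (N (X w) (Y w)) ∂μ
      = ∫ z, inner ℝ z.1.2 (N z.1.1 z.2) ∂(μ.map fun w => ((X w, Z w), Y w)) := by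
        rw [integral_map (hXZ.prodMk hY).aemeasurable hF.aestronglyMeasurable]
    _ = ∫ u, ∫ b, inner ℝ u.2 (N u.1 b) ∂ν ∂(μ.map fun w => (X w, Z w)) := by
        rw [hmap, integral_prod _ hi]
    _ = 0 := by
        simp_rw [fun u : E × E => integral_inner (𝕜 := ℝ) (hint u.1) u.2, h0, inner_zero_right,
          integral_zero]

end Noise

/-! ### Each batch, and each sample, is independent of all the rest. -/

section Independence

variable {Ω : Type*} {mΩ : MeasurableSpace Ω} {μ : Measure Ω}

/-- Regrouping of independence. The sets `a ∩ b` form a π-system generating `m₂ ⊔ m₃`, and `P(s ∩ a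
∩ b) = P(s ∩ a) P(b) = P(s) P(a) P(b) = P(s) P(a ∩ b)`. -/
lemma indep_sup_right_of_indep_sup_left [IsProbabilityMeasure μ] {m₁ m₂ m₃ : MeasurableSpace Ω}
    (h₁ : m₁ ≤ mΩ) (h₂ : m₂ ≤ mΩ) (h₃ : m₃ ≤ mΩ) (h : Indep m₁ m₂ μ)
    (h' : Indep (m₁ ⊔ m₂) m₃ μ) : Indep m₁ (m₂ ⊔ m₃) μ := by
  let π : Set (Set Ω) := {s | ∃ a b, MeasurableSet[m₂] a ∧ MeasurableSet[m₃] b ∧ s = a ∩ b}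
  have hπ : m₂ ⊔ m₃ = MeasurableSpace.generateFrom π := by
    refine le_antisymm (sup_le (fun s hs => ?_) fun s hs => ?_)
      (MeasurableSpace.generateFrom_le ?_)
    · exact MeasurableSpace.measurableSet_generateFrom ⟨s, Set.univ, hs, .univ, by simp⟩
    · exact MeasurableSpace.measurableSet_generateFrom ⟨Set.univ, s, .univ, hs, by simp⟩
    · rintro _ ⟨a, b, ha, hb, rfl⟩
      exact MeasurableSet.inter ((le_sup_left : m₂ ≤ m₂ ⊔ m₃) a ha)
        ((le_sup_right : m₃ ≤ m₂ ⊔ m₃) b hb)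
  refine IndepSets.indep h₁ (sup_le h₂ h₃) (@MeasurableSpace.isPiSystem_measurableSet Ω m₁) ?_
    (@MeasurableSpace.generateFrom_measurableSet Ω m₁).symm hπ ?_
  · rintro _ ⟨a, b, ha, hb, rfl⟩ _ ⟨a', b', ha', hb', rfl⟩ -
    exact ⟨a ∩ a', b ∩ b', ha.inter ha', hb.inter hb', Set.inter_inter_inter_comm _ _ _ _⟩
  · rw [IndepSets_iff]
    rintro s _ hs ⟨a, b, ha, hb, rfl⟩
    rw [Indep_iff] at h h'
    have hs' : MeasurableSet[m₁ ⊔ m₂] s := (le_sup_left : m₁ ≤ m₁ ⊔ m₂) s hs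
    have ha' : MeasurableSet[m₁ ⊔ m₂] a := (le_sup_right : m₂ ≤ m₁ ⊔ m₂) a ha
    rw [← Set.inter_assoc, h' _ _ (hs'.inter ha') hb, h _ _ hs ha, h' _ _ ha' hb, mul_assoc]

lemma indepFun_of_measurable_of_indep {α β : Type*} {mα : MeasurableSpace α}
    {mβ : MeasurableSpace β} {m : MeasurableSpace Ω} {X : Ω → α} {Y : Ω → β}
    (hX : Measurable[m] X) (h : Indep m (mβ.comap Y) μ) : IndepFun X Y μ :=
  indep_of_indep_of_le_left h hX.comap_le

end Independence

section SigmaAlgebras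

variable {n m : ℕ} {Ξ Ω : Type*} [mΞ : MeasurableSpace Ξ]
  {S : ℕ → Ω → Fin m → Fin n} {ξ : ℕ → Fin n → ℕ → Ω → Ξ}

/-- The `σ`-algebra generated by all samples and by all batches except the batch `q`. -/
abbrev sigmaExceptBatch (S : ℕ → Ω → Fin m → Fin n) (ξ : ℕ → Fin n → ℕ → Ω → Ξ)
    (q : ℕ × Fin n × ℕ) : MeasurableSpace Ω :=
  (⨆ q' ∈ ({q}ᶜ : Set (ℕ × Fin n × ℕ)), mΞ.comap (ξ q'.1 q'.2.1 q'.2.2))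
    ⊔ ⨆ u, MeasurableSpace.pi.comap (S u)

/-- The `σ`-algebra generated by all batches and by all samples except that of round `t`. -/
abbrev sigmaExceptSample (S : ℕ → Ω → Fin m → Fin n) (ξ : ℕ → Fin n → ℕ → Ω → Ξ)
    (t : ℕ) : MeasurableSpace Ω :=
  (⨆ u ∈ ({t}ᶜ : Set ℕ), MeasurableSpace.pi.comap (S u))
    ⊔ ⨆ q : ℕ × Fin n × ℕ, mΞ.comap (ξ q.1 q.2.1 q.2.2)

lemma measurable_batch_sigmaExceptBatch {q q' : ℕ × Fin n × ℕ} (hq : q' ≠ q) :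
    Measurable[sigmaExceptBatch S ξ q] (ξ q'.1 q'.2.1 q'.2.2) :=
  Measurable.of_comap_le (le_sup_of_le_left
    (le_iSup₂_of_le (f := fun (q' : ℕ × Fin n × ℕ) (_ : q' ∈ ({q}ᶜ : Set (ℕ × Fin n × ℕ))) =>
      mΞ.comap (ξ q'.1 q'.2.1 q'.2.2)) q' hq le_rfl))

lemma measurable_sample_sigmaExceptBatch (q : ℕ × Fin n × ℕ) (u : ℕ) :
    Measurable[sigmaExceptBatch S ξ q] (S u) :=
  Measurable.of_comap_le (le_sup_of_le_right (le_iSup (fun u => MeasurableSpace.pi.comap (S u)) u))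

lemma measurable_batch_sigmaExceptSample (t u : ℕ) (i : Fin n) (k : ℕ) :
    Measurable[sigmaExceptSample S ξ t] (ξ u i k) :=
  Measurable.of_comap_le (le_sup_of_le_right
    (le_iSup (fun q : ℕ × Fin n × ℕ => mΞ.comap (ξ q.1 q.2.1 q.2.2)) (u, i, k)))

lemma measurable_sample_sigmaExceptSample {t u : ℕ} (hu : u ≠ t) :
    Measurable[sigmaExceptSample S ξ t] (S u) :=
  Measurable.of_comap_le (le_sup_of_le_left
    (le_iSup₂_of_le (f := fun u (_ : u ∈ ({t}ᶜ : Set ℕ)) =>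
      MeasurableSpace.pi.comap (S u)) u hu le_rfl))

end SigmaAlgebras

section Randomness

variable {n m : ℕ} {Ξ Ω : Type*} [mΞ : MeasurableSpace Ξ] [mΩ : MeasurableSpace Ω]
  {μ : Measure Ω} {P : Measure (Fin m → Fin n)} {ν : Fin n → Measure Ξ}
  {S : ℕ → Ω → Fin m → Fin n} {ξ : ℕ → Fin n → ℕ → Ω → Ξ}

lemma IsFedAvgRandomness.indep_iSup (h : IsFedAvgRandomness μ P ν S ξ) :
    Indep (⨆ u, MeasurableSpace.pi.comap (S u))
      (⨆ q : ℕ × Fin n × ℕ, mΞ.comap (ξ q.1 q.2.1 q.2.2)) μ := by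
  refine indep_of_indep_of_le_left (indep_of_indep_of_le_right h.indep_sample_batch
    (iSup_le fun q => ?_)) (iSup_le fun u => ?_)
  · have := (measurable_pi_apply (X := fun _ : ℕ × Fin n × ℕ => Ξ) q).comp
      (comap_measurable (m := MeasurableSpace.pi)
        fun w (q : ℕ × Fin n × ℕ) => ξ q.1 q.2.1 q.2.2 w)
    exact this.comap_le
  · have := (measurable_pi_apply (X := fun _ : ℕ => Fin m → Fin n) u).comp
      (comap_measurable (m := MeasurableSpace.pi) fun w t => S t w)
    exact this.comap_le

/-- Regroup with `m₁` the batch `q`, `m₂` the other batches and `m₃` the samples. -/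
lemma IsFedAvgRandomness.indep_sigmaExceptBatch [IsProbabilityMeasure μ]
    (h : IsFedAvgRandomness μ P ν S ξ) (q : ℕ × Fin n × ℕ) :
    Indep (sigmaExceptBatch S ξ q) (mΞ.comap (ξ q.1 q.2.1 q.2.2)) μ := by
  have hb : ∀ q : ℕ × Fin n × ℕ, mΞ.comap (ξ q.1 q.2.1 q.2.2) ≤ mΩ :=
    fun q => (h.measurable_batch _ _ _).comap_le
  have h1 := indep_iSup_of_disjoint hb ((iIndepFun_iff_iIndep _ _ _).1 h.indep_batch)
    (S := {q}) (T := {q}ᶜ) (Set.disjoint_compl_right_iff_subset.2 subset_rfl)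
  rw [iSup_singleton] at h1
  refine (indep_sup_right_of_indep_sup_left (hb q) (iSup₂_le fun q _ => hb q)
    (iSup_le fun u => (h.measurable_sample u).comap_le) h1 ?_).symm
  exact (indep_of_indep_of_le_right h.indep_iSup
    (sup_le (le_iSup (fun q : ℕ × Fin n × ℕ => mΞ.comap (ξ q.1 q.2.1 q.2.2)) q)
      (iSup₂_le_iSup _ _))).symm

lemma IsFedAvgRandomness.indep_sigmaExceptSample [IsProbabilityMeasure μ]
    (h : IsFedAvgRandomness μ P ν S ξ) (t : ℕ) :
    Indep (sigmaExceptSample S ξ t) (MeasurableSpace.pi.comap (S t)) μ := by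
  have hb : ∀ u, MeasurableSpace.pi.comap (S u) ≤ mΩ := fun u => (h.measurable_sample u).comap_le
  have h1 := indep_iSup_of_disjoint hb ((iIndepFun_iff_iIndep _ _ _).1 h.indep_sample)
    (S := {t}) (T := {t}ᶜ) (Set.disjoint_compl_right_iff_subset.2 subset_rfl)
  rw [iSup_singleton] at h1
  refine (indep_sup_right_of_indep_sup_left (hb t) (iSup₂_le fun q _ => hb q)
    (iSup_le fun q => (h.measurable_batch _ _ _).comap_le) h1 ?_).symm
  exact indep_of_indep_of_le_left h.indep_iSup
    (sup_le (le_iSup (fun u => MeasurableSpace.pi.comap (S u)) t) (iSup₂_le_iSup _ _))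

end Randomness

/-! ### Measurability of the iterates with respect to an arbitrary σ-algebra. -/

section Measurability

variable {n m d : ℕ} {Ξ Ω : Type*} [MeasurableSpace Ξ] {mΩ : MeasurableSpace Ω}

lemma measurable_localModel {g : Model d → Ξ → Model d} (hg : Measurable (Function.uncurry g))
    (ηl : ℝ) {θ : Ω → Model d} (hθ : Measurable θ) {b : ℕ → Ω → Ξ} {k : ℕ}
    (hb : ∀ l < k, Measurable (b l)) :
    Measurable fun w => localModel g ηl (θ w) (fun l => b l w) k := by
  induction k with
  | zero => exact hθ
  | succ k ih =>
    have h1 := ih fun l hl => hb l (hl.trans k.lt_succ_self)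
    exact h1.sub ((hg.comp (h1.prodMk (hb k k.lt_succ_self))).const_smul ηl)

lemma measurable_aggWeight (i : Fin n) : Measurable fun s : Fin m → Fin n => aggWeight s i :=
  measurable_of_finite _

/-- Only rounds before `t` are required to be measurable, and the σ-algebra on `Ω` is free: it is
later taken to omit one batch or one sample. -/
lemma measurable_globalModel {g : Fin n → Model d → Ξ → Model d}
    (hg : ∀ i, Measurable (Function.uncurry (g i))) (ηl ηg : ℝ) (K : ℕ) (θ₀ : Model d)
    {S : ℕ → Ω → Fin m → Fin n} {ξ : ℕ → Fin n → ℕ → Ω → Ξ} {t : ℕ}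
    (hS : ∀ u < t, Measurable (S u)) (hξ : ∀ u < t, ∀ i k, Measurable (ξ u i k)) :
    Measurable fun w => globalModel g ηl ηg K θ₀ (fun u => S u w) (fun u i k => ξ u i k w) t := by
  induction t with
  | zero => exact measurable_const
  | succ t ih =>
    have h1 := ih (fun u hu => hS u (hu.trans t.lt_succ_self))
      fun u hu => hξ u (hu.trans t.lt_succ_self)
    refine h1.add ((Finset.measurable_fun_sum _ fun i _ => ?_).const_smul ηg)
    exact ((measurable_aggWeight i).comp (hS t t.lt_succ_self)).smul
      ((measurable_localModel (hg i) ηl h1 fun l _ => hξ t t.lt_succ_self i l).sub h1)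

end Measurability

/-! ### Drift of the local iterates within a round. -/

section Drift

lemma norm_lipschitz_sq_le {E : Type*} [NormedAddCommGroup E] {G : E → E} {L : ℝ≥0}
    (hG : LipschitzWith L G) (x y : E) :
    ‖G x - G y‖ ^ 2 ≤ (L : ℝ) ^ 2 * ‖x - y‖ ^ 2 := by
  have := hG.dist_le_mul x y
  rw [dist_eq_norm, dist_eq_norm] at this
  rw [← mul_pow]
  exact pow_le_pow_left₀ (norm_nonneg _) this 2

variable {Ω : Type*} [MeasurableSpace Ω] {μ : Measure Ω} [IsProbabilityMeasure μ]
  {E : Type*} [NormedAddCommGroup E] [InnerProductSpace ℝ E]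

/-- If each partial sum of a nonnegative sequence controls the next term, then a small step size
controls the whole sum. -/
lemma sum_le_of_discrete_gronwall {a : ℕ → ℝ} (ha : ∀ k, 0 ≤ a k) {η L V G : ℝ} (hV : 0 ≤ V)
    (hG : 0 ≤ G) {K : ℕ} (hK : 0 < K) (hη : η ^ 2 * L ^ 2 * K ^ 2 ≤ 1 / 32)
    (h : ∀ k, a k ≤ 2 * η ^ 2 * (k * V + 2 * k ^ 2 * G + 2 * k * L ^ 2 * ∑ j ∈ Finset.range k,
    a j)) :
    ∑ k ∈ Finset.range K, a k
      ≤ 2 * η ^ 2 * K * (K - 1) * V + 4 * η ^ 2 * K ^ 2 * (K - 1) * G := by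
  set X := ∑ k ∈ Finset.range K, a k with hX
  have hX0 : 0 ≤ X := Finset.sum_nonneg fun k _ => ha k
  have hK1 : (1 : ℝ) ≤ K := by exact_mod_cast hK
  have hs : ∑ k ∈ Finset.range K, (k : ℝ) = K * (K - 1) / 2 := by
    have := Finset.sum_range_id_mul_two K
    have h2 : (∑ k ∈ Finset.range K, (k : ℝ)) * 2 = K * (K - 1) := by
      have h3 : ((K - 1 : ℕ) : ℝ) = K - 1 := by rw [Nat.cast_sub hK, Nat.cast_one]
      rw [← h3, ← Nat.cast_sum]
      exact_mod_cast this
    linarith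
  have h1 : X ≤ ∑ k ∈ Finset.range K, (k : ℝ) * (2 * η ^ 2 * (V + 2 * K * G + 2 * L ^ 2 * X)) := by
    refine Finset.sum_le_sum fun k hk => (h k).trans ?_
    have hkK : (k : ℝ) ≤ K := by exact_mod_cast (Finset.mem_range.1 hk).le
    have hsub : ∑ j ∈ Finset.range k, a j ≤ X :=
      Finset.sum_le_sum_of_subset_of_nonneg (Finset.range_mono (Finset.mem_range.1 hk).le)
        fun j _ _ => ha j
    -- Using `k² ≤ k K` rather than `K²` keeps a factor `k`, whose sum `K (K - 1) / 2` vanishes when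
    -- `K = 1`.
    calc 2 * η ^ 2 * (k * V + 2 * k ^ 2 * G + 2 * k * L ^ 2 * ∑ j ∈ Finset.range k, a j)
        ≤ 2 * η ^ 2 * (k * V + 2 * (k * K) * G + 2 * k * L ^ 2 * X) := by
          gcongr
          rw [sq]
          gcongr
      _ = _ := by ring
  rw [← Finset.sum_mul, hs] at h1
  -- The sum `X` thus reappears on the right with coefficient at most `1/16` and is absorbed; the
  -- doubled constants in the conclusion leave room for this.
  have h2 : η ^ 2 * L ^ 2 * (K * (K - 1)) * X ≤ 1 / 32 * X := by
    refine mul_le_mul_of_nonneg_right (le_trans ?_ hη) hX0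
    gcongr
    nlinarith
  have h3 : 0 ≤ η ^ 2 * (K * (K - 1)) * V := by
    have : 0 ≤ (K : ℝ) - 1 := by linarith
    positivity
  have h4 : 0 ≤ η ^ 2 * (K ^ 2 * (K - 1)) * G := by
    have : 0 ≤ (K : ℝ) - 1 := by linarith
    positivity
  nlinarith

/-- After `k` steps the displacement is a noise sum plus a gradient sum. Orthogonality makes the
noise cost `k σ²` instead of `k² σ²`; the gradients cost `k` times their squares, themselves bounded
by earlier drift. -/
lemma local_drift_le {G : E → E} {L : ℝ≥0} (hG : LipschitzWith L G) {η σ : ℝ}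
    {y N : ℕ → Ω → E} (hstep : ∀ k w, y (k + 1) w = y k w - η • (G (y k w) + N k w))
    (hy : ∀ k, MemLp (y k) 2 μ) (hN : ∀ k, MemLp (N k) 2 μ)
    (horth : ∀ j k, j ≠ k → ∫ w, inner ℝ (N j w) (N k w) ∂μ = 0)
    (hσ : ∀ k, ∫ w, ‖N k w‖ ^ 2 ∂μ ≤ σ ^ 2) {K : ℕ} (hK : 0 < K)
    (hη : η ^ 2 * L ^ 2 * K ^ 2 ≤ 1 / 32) :
    ∑ k ∈ Finset.range K, ∫ w, ‖y k w - y 0 w‖ ^ 2 ∂μ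
      ≤ 2 * η ^ 2 * K * (K - 1) * σ ^ 2
        + 4 * η ^ 2 * K ^ 2 * (K - 1) * ∫ w, ‖G (y 0 w)‖ ^ 2 ∂μ := by
  refine sum_le_of_discrete_gronwall (fun k => integral_nonneg fun _ => by positivity)
    (sq_nonneg σ) (integral_nonneg fun _ => by positivity) hK hη fun k => ?_
  have hexp : ∀ w, y k w - y 0 w
      = -(η • (∑ j ∈ Finset.range k, N j w + ∑ j ∈ Finset.range k, G (y j w))) := by
    intro w
    induction k with
    | zero => simp
    | succ k ih =>
      rw [hstep, Finset.sum_range_succ, Finset.sum_range_succ, sub_right_comm, ih]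
      module
  have hpt : ∀ w, ‖y k w - y 0 w‖ ^ 2 ≤ 2 * η ^ 2 * (‖∑ j ∈ Finset.range k, N j w‖ ^ 2
      + (2 * k ^ 2 * ‖G (y 0 w)‖ ^ 2
        + 2 * k * L ^ 2 * ∑ j ∈ Finset.range k, ‖y j w - y 0 w‖ ^ 2)) := by
    intro w
    rw [hexp, norm_neg, norm_smul, mul_pow, Real.norm_eq_abs, sq_abs]
    have h1 := norm_add_sq_le (∑ j ∈ Finset.range k, N j w) (∑ j ∈ Finset.range k, G (y j w))
    have h2 := norm_sum_sq_le (Finset.range k) fun j => G (y j w)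
    rw [Finset.card_range] at h2
    have h3 : ∑ j ∈ Finset.range k, ‖G (y j w)‖ ^ 2
        ≤ ∑ j ∈ Finset.range k, (2 * ‖G (y 0 w)‖ ^ 2 + 2 * (L ^ 2 * ‖y j w - y 0 w‖ ^ 2)) := by
      gcongr with j
      have := norm_add_sq_le (G (y 0 w)) (G (y j w) - G (y 0 w))
      rw [add_sub_cancel] at this
      linarith [norm_lipschitz_sq_le hG (y j w) (y 0 w)]
    rw [Finset.sum_add_distrib, Finset.sum_const, Finset.card_range, nsmul_eq_mul,
      ← Finset.mul_sum, ← Finset.mul_sum] at h3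
    have h4 := mul_le_mul_of_nonneg_left h3 (Nat.cast_nonneg (α := ℝ) k)
    nlinarith [mul_le_mul_of_nonneg_left (h1.trans (by linarith [h2.trans h4] :
      _ ≤ 2 * (‖∑ j ∈ Finset.range k, N j w‖ ^ 2 + (2 * k ^ 2 * ‖G (y 0 w)‖ ^ 2
        + 2 * k * L ^ 2 * ∑ j ∈ Finset.range k, ‖y j w - y 0 w‖ ^ 2)))) (sq_nonneg η)]
  have hi1 : Integrable (fun w => ‖∑ j ∈ Finset.range k, N j w‖ ^ 2) μ :=
    integrable_norm_sq_of_memLp (memLp_finsetSum _ fun j _ => hN j)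
  have hi2 : Integrable (fun w => ‖G (y 0 w)‖ ^ 2) μ :=
    integrable_norm_sq_of_memLp (memLp_comp_of_lipschitzWith hG (hy 0))
  have hi3 : ∀ j, Integrable (fun w => ‖y j w - y 0 w‖ ^ 2) μ := fun j =>
    integrable_norm_sq_of_memLp ((hy j).sub (hy 0))
  have hi4 : Integrable (fun w => ∑ j ∈ Finset.range k, ‖y j w - y 0 w‖ ^ 2) μ :=
    integrable_finsetSum _ fun j _ => hi3 j
  have hi5 : Integrable (fun w => 2 * (k : ℝ) ^ 2 * ‖G (y 0 w)‖ ^ 2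
      + 2 * k * L ^ 2 * ∑ j ∈ Finset.range k, ‖y j w - y 0 w‖ ^ 2) μ :=
    (hi2.const_mul _).add (hi4.const_mul _)
  refine (integral_mono (hi3 k) ((hi1.add hi5).const_mul _) hpt).trans ?_
  simp only [Pi.add_apply]
  rw [integral_const_mul, integral_add hi1 hi5,
    integral_add (hi2.const_mul _) (hi4.const_mul _), integral_const_mul, integral_const_mul,
    integral_finsetSum _ fun j _ => hi3 j,
    integral_norm_sum_sq_of_orthogonal _ (fun j _ => hN j) fun j _ k _ hjk => horth j k hjk]
  have h5 : ∑ j ∈ Finset.range k, ∫ w, ‖N j w‖ ^ 2 ∂μ ≤ k * σ ^ 2 := by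
    refine (Finset.sum_le_sum fun j _ => hσ j).trans_eq ?_
    simp
  rw [add_assoc]
  gcongr

end Drift

/-! ### Aggregation with a sample independent of the aggregated vectors. -/

section Aggregation

variable {n m : ℕ} {p : Fin n → ℝ} {r : Fin m → Fin n → ℝ}
  {Ω : Type*} [MeasurableSpace Ω] {μ : Measure Ω}
  {E : Type*} [NormedAddCommGroup E] [InnerProductSpace ℝ E]

lemma memLp_aggWeight_smul {S : Ω → Fin m → Fin n} (hS : Measurable S) (i : Fin n) {X : Ω → E}
    (hX : MemLp X 2 μ) : MemLp (fun w => aggWeight (S w) i • X w) 2 μ := by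
  refine hX.of_le (((measurable_aggWeight i).comp hS).aestronglyMeasurable.smul hX.1)
    (ae_of_all _ fun w => ?_)
  rw [norm_smul, Real.norm_of_nonneg (aggWeight_nonneg _ _)]
  exact mul_le_of_le_one_left (norm_nonneg _) (aggWeight_le_one _ _)

variable [MeasurableSpace E] [BorelSpace E] [SecondCountableTopology E] {S : Ω → Fin m → Fin n}

lemma IsClusteredScheme.integral_inner_aggregate (h : IsClusteredScheme p r) (hm : 0 < m)
    (hS : Measurable S) (hlaw : HasLaw S (clusteredLaw r) μ) {v : Ω → E} {x : Fin n → Ω → E}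
    (hv : MemLp v 2 μ) (hx : ∀ i, MemLp (x i) 2 μ)
    (hind : IndepFun (fun w => (v w, fun i => x i w)) S μ) :
    ∫ w, inner ℝ (v w) (∑ i, aggWeight (S w) i • x i w) ∂μ
      = ∫ w, inner ℝ (v w) (∑ i, p i • x i w) ∂μ := by
  simp_rw [inner_sum]
  rw [integral_finsetSum _ fun i _ =>
      integrable_inner_of_memLp hv (memLp_aggWeight_smul hS i (hx i)),
    integral_finsetSum (f := fun i w => inner ℝ (v w) (p i • x i w)) _ fun i _ =>
      integrable_inner_of_memLp hv ((hx i).const_smul (p i))]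
  refine Finset.sum_congr rfl fun i _ => ?_
  simp_rw [real_inner_smul_right]
  have hi : IndepFun (fun w => aggWeight (S w) i) (fun w => inner ℝ (v w) (x i w)) μ :=
    (hind.comp (φ := fun z : E × (Fin n → E) => inner ℝ z.1 (z.2 i)) (by fun_prop)
      (measurable_aggWeight i)).symm
  rw [hi.integral_fun_mul_eq_mul_integral
    ((measurable_aggWeight i).comp hS).aestronglyMeasurable (hv.1.inner (hx i).1),
    integral_const_mul, ← h.integral_aggWeight hm i]
  congr 1
  exact hlaw.integral_comp (f := fun s => aggWeight s i)
    (measurable_aggWeight i).aestronglyMeasurable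

/-- Expanding the square separates `ω_i ω_j` from `⟨x_i, x_j⟩`, so independence allows averaging
over the sample first; then the Jensen-type inequality applies pointwise. -/
lemma IsClusteredScheme.integral_norm_sq_aggregate_le [IsProbabilityMeasure μ]
    (h : IsClusteredScheme p r) (hm : 0 < m)
    (hS : Measurable S) (hlaw : HasLaw S (clusteredLaw r) μ) {x : Fin n → Ω → E}
    (hx : ∀ i, MemLp (x i) 2 μ) (hind : IndepFun (fun w i => x i w) S μ) :
    ∫ w, ‖∑ i, aggWeight (S w) i • x i w‖ ^ 2 ∂μ
      ≤ ∑ i, p i / m * ∫ w, ‖x i w‖ ^ 2 ∂μ + (1 - 1 / m) * ∫ w, ‖∑ i, p i • x i w‖ ^ 2 ∂μ := by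
  have := h.isProbabilityMeasure_clusteredLaw
  have hij : ∀ i j, Integrable (fun w => inner ℝ (x i w) (x j w)) μ := fun i j =>
    integrable_inner_of_memLp (hx i) (hx j)
  have hmul : ∀ i j : Fin n, Measurable fun s : Fin m → Fin n => aggWeight s i * aggWeight s j :=
    fun i j => measurable_of_finite _
  have hsum : ∀ w, Integrable (fun s => ∑ i, ∑ j, aggWeight s i * aggWeight s j
      * inner ℝ (x i w) (x j w)) (clusteredLaw r) := fun w => .of_finite
  have e : ∫ w, ‖∑ i, aggWeight (S w) i • x i w‖ ^ 2 ∂μ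
      = ∫ w, ∫ s, ‖∑ i, aggWeight s i • x i w‖ ^ 2 ∂(clusteredLaw r) ∂μ := by
    have hl : ∀ i j, Integrable (fun w => aggWeight (S w) i * aggWeight (S w) j
        * inner ℝ (x i w) (x j w)) μ := by
      intro i j
      have := integrable_inner_of_memLp (memLp_aggWeight_smul hS j (hx i))
        (memLp_aggWeight_smul hS i (hx j))
      simpa only [real_inner_smul_left, real_inner_smul_right, mul_assoc] using this
    simp_rw [norm_sq_sum_smul]
    simp_rw [integral_finsetSum (μ := clusteredLaw r) Finset.univ fun _ _ => .of_finite,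
      integral_mul_const]
    rw [integral_finsetSum _ fun i _ => integrable_finsetSum _ fun j _ => hl i j,
      integral_finsetSum _ fun i _ => integrable_finsetSum _ fun j _ => (hij i j).const_mul _]
    refine Finset.sum_congr rfl fun i _ => ?_
    rw [integral_finsetSum _ fun j _ => hl i j,
      integral_finsetSum _ fun j _ => (hij i j).const_mul _]
    refine Finset.sum_congr rfl fun j _ => ?_
    have hi : IndepFun (fun w => aggWeight (S w) i * aggWeight (S w) j)
        (fun w => inner ℝ (x i w) (x j w)) μ :=
      (hind.comp (φ := fun z : Fin n → E => inner ℝ (z i) (z j)) (by fun_prop) (hmul i j)).symm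
    rw [hi.integral_fun_mul_eq_mul_integral ((hmul i j).comp hS).aestronglyMeasurable
      ((hx i).1.inner (hx j).1), integral_const_mul]
    congr 1
    exact hlaw.integral_comp (f := fun s => aggWeight s i * aggWeight s j)
      (hmul i j).aestronglyMeasurable
  have hi1 : Integrable (fun w => ∑ i, p i / m * ‖x i w‖ ^ 2) μ :=
    integrable_finsetSum _ fun i _ => (integrable_norm_sq_of_memLp (hx i)).const_mul _
  have hi2 : Integrable (fun w => ‖∑ i, p i • x i w‖ ^ 2) μ :=
    integrable_norm_sq_of_memLp (memLp_finsetSum _ fun i _ => (hx i).const_smul (p i))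
  rw [e]
  calc ∫ w, ∫ s, ‖∑ i, aggWeight s i • x i w‖ ^ 2 ∂(clusteredLaw r) ∂μ
      ≤ ∫ w, (∑ i, p i / m * ‖x i w‖ ^ 2 + (1 - 1 / m) * ‖∑ i, p i • x i w‖ ^ 2) ∂μ := by
        refine integral_mono_of_nonneg (ae_of_all _ fun w => integral_nonneg fun s => sq_nonneg _)
          (hi1.add (hi2.const_mul _)) (ae_of_all _ fun w => ?_)
        have := h.jensen_le hm fun i => x i w
        simp_rw [h.gammaStat_md hm] at this
        exact this
    _ = _ := by
        rw [integral_add hi1 (hi2.const_mul _), integral_const_mul, integral_finsetSum _ fun i _ =>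
          (integrable_norm_sq_of_memLp (hx i)).const_mul _]
        simp_rw [integral_const_mul]

end Aggregation

/-! ### Expected decrease of the loss in one round. -/

section RoundDescent

/-- The real arithmetic of a round: `F`, `F'` are expected losses, `I` the linear term, `Q` and `Z`
the second moments of aggregated gradients and noise, `G = E‖∇ℒ‖²`, `D` its clientwise average, `R`
the scaled drift, `ι = 1/m`. Of the gain `aKG/2`, `Q` uses at most `aKG/8` and the total drift
weight `5aR/8` uses `5aKG/64`, so `aKG/4` survives. -/
lemma descent_of_moment_bounds {F F' a L K I Q Z G R D V σ κ β η ι : ℝ} (ha : 0 ≤ a) (hL : 0 ≤ L)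
    (hK : 1 ≤ K) (hι : 0 ≤ ι) (hβ : 1 ≤ β ^ 2) (hG : 0 ≤ G) (hR : 0 ≤ R)
    (hF : F' ≤ F - a * I + L * a ^ 2 * (Q + Z)) (hI : K / 2 * G - R / 2 ≤ I)
    (hZ : Z ≤ V * K * σ ^ 2)
    (hQ : Q ≤ ι * (2 * K ^ 2 * D + 2 * K * R) + (1 - ι) * (2 * K ^ 2 * G + 2 * K * R))
    (hD : D ≤ β ^ 2 * G + κ ^ 2)
    (hRD : R ≤ L ^ 2 * (2 * η ^ 2 * K * (K - 1) * σ ^ 2 + 4 * η ^ 2 * K ^ 2 * (K - 1) * D))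
    (h1 : β ^ 2 * η ^ 2 * L ^ 2 * K ^ 2 ≤ 1 / 32) (h2 : L * a * (1 - ι) * K ≤ 1 / 32)
    (h3 : L * a * K * ι * β ^ 2 ≤ 1 / 32) :
    a * K / 4 * G ≤ F - F' + a * (2 * L ^ 2 * η ^ 2 * K * (K - 1) * σ ^ 2
      + 4 * L ^ 2 * η ^ 2 * K ^ 2 * (K - 1) * κ ^ 2) + L * a ^ 2 * K * V * σ ^ 2
      + 2 * L * a ^ 2 * K ^ 2 * ι * κ ^ 2 := by
  have hK0 : 0 ≤ K := by linarith
  have hK1 : 0 ≤ K - 1 := by linarith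
  -- Add the two step-size conditions, using `β² ≥ 1`. This absorbs the drift part of `Q`, including
  -- its `σ²` contribution.
  have h4 : L * a * K ≤ 1 / 16 := by
    have : L * a * K * ι * 1 ≤ L * a * K * ι * β ^ 2 := by gcongr
    linarith
  have hZ' : L * a ^ 2 * Z ≤ L * a ^ 2 * (V * K * σ ^ 2) := by gcongr
  have hQ' : L * a ^ 2 * Q ≤ a * K * G / 8 + a * R / 8 + 2 * L * a ^ 2 * K ^ 2 * ι * κ ^ 2 := by
    have e1 : L * a ^ 2 * Q ≤ L * a ^ 2 * (ι * (2 * K ^ 2 * (β ^ 2 * G + κ ^ 2) + 2 * K * R)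
        + (1 - ι) * (2 * K ^ 2 * G + 2 * K * R)) := by
      gcongr
      exact hQ.trans (by gcongr)
    have e2 := mul_le_mul_of_nonneg_right h3 (by positivity : 0 ≤ 2 * a * K * G)
    have e3 := mul_le_mul_of_nonneg_right h2 (by positivity : 0 ≤ 2 * a * K * G)
    have e4 := mul_le_mul_of_nonneg_right h4 (by positivity : 0 ≤ 2 * a * R)
    linarith
  have hR' : R ≤ 2 * L ^ 2 * η ^ 2 * K * (K - 1) * σ ^ 2
      + 4 * L ^ 2 * η ^ 2 * K ^ 2 * (K - 1) * κ ^ 2 + K * G / 8 := by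
    have e1 : R ≤ L ^ 2 * (2 * η ^ 2 * K * (K - 1) * σ ^ 2
        + 4 * η ^ 2 * K ^ 2 * (K - 1) * (β ^ 2 * G + κ ^ 2)) := by
      refine hRD.trans ?_
      gcongr
    have e2 : β ^ 2 * η ^ 2 * L ^ 2 * (K ^ 2 * (K - 1)) ≤ 1 / 32 * K := by
      calc β ^ 2 * η ^ 2 * L ^ 2 * (K ^ 2 * (K - 1))
          ≤ β ^ 2 * η ^ 2 * L ^ 2 * (K ^ 2 * K) := by gcongr; linarith
        _ = β ^ 2 * η ^ 2 * L ^ 2 * K ^ 2 * K := by ring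
        _ ≤ _ := by gcongr
    have e3 := mul_le_mul_of_nonneg_right e2 (by positivity : 0 ≤ 4 * G)
    linarith
  have hI' := mul_le_mul_of_nonneg_left hI ha
  have hR'' := mul_le_mul_of_nonneg_left hR' ha
  have hB : 0 ≤ a * (2 * L ^ 2 * η ^ 2 * K * (K - 1) * σ ^ 2
      + 4 * L ^ 2 * η ^ 2 * K ^ 2 * (K - 1) * κ ^ 2) := by positivity
  have hKG : 0 ≤ a * (K * G) := by positivity
  linarith

variable {n m d : ℕ} {p : Fin n → ℝ} {r : Fin m → Fin n → ℝ}
  {Ω : Type*} [MeasurableSpace Ω] {μ : Measure Ω}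
  {S : Ω → Fin m → Fin n}

lemma integral_norm_sub_smul_sq_le [IsProbabilityMeasure μ] {E : Type*} [NormedAddCommGroup E]
    [InnerProductSpace ℝ E]
    {G : E → E} {L : ℝ≥0} (hG : LipschitzWith L G) {K : ℕ} {y : ℕ → Ω → E} {θ : Ω → E}
    (hθ : MemLp θ 2 μ) (hy : ∀ k, MemLp (y k) 2 μ) :
    ∫ w, ‖∑ k ∈ Finset.range K, G (y k w) - (K : ℝ) • G (θ w)‖ ^ 2 ∂μ
      ≤ K * (L ^ 2 * ∑ k ∈ Finset.range K, ∫ w, ‖y k w - θ w‖ ^ 2 ∂μ) := by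
  have hi : ∀ k, Integrable (fun w => ‖y k w - θ w‖ ^ 2) μ := fun k =>
    integrable_norm_sq_of_memLp ((hy k).sub hθ)
  rw [← integral_finsetSum _ fun k _ => hi k, ← integral_const_mul, ← integral_const_mul]
  refine integral_mono_of_nonneg (ae_of_all _ fun w => sq_nonneg _)
    (((integrable_finsetSum _ fun k _ => hi k).const_mul _).const_mul _) (ae_of_all _ fun w => ?_)
  have e : ∑ k ∈ Finset.range K, G (y k w) - (K : ℝ) • G (θ w)
      = ∑ k ∈ Finset.range K, (G (y k w) - G (θ w)) := by
    rw [Finset.sum_sub_distrib, Finset.sum_const, Finset.card_range, Nat.cast_smul_eq_nsmul]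
  have h1 := norm_sum_sq_le (Finset.range K) fun k => G (y k w) - G (θ w)
  rw [Finset.card_range] at h1
  simp only [e]
  refine h1.trans ?_
  rw [Finset.mul_sum _ _ ((L : ℝ) ^ 2)]
  exact mul_le_mul_of_nonneg_left (Finset.sum_le_sum fun k _ => norm_lipschitz_sq_le hG _ _)
    (Nat.cast_nonneg K)

lemma integral_norm_sq_le_of_sub_smul {E : Type*} [NormedAddCommGroup E] [InnerProductSpace ℝ E]
    {X Y : Ω → E} (hX : MemLp X 2 μ) (hY : MemLp Y 2 μ) (c : ℝ) :
    ∫ w, ‖X w‖ ^ 2 ∂μ ≤ 2 * c ^ 2 * ∫ w, ‖Y w‖ ^ 2 ∂μ + 2 * ∫ w, ‖X w - c • Y w‖ ^ 2 ∂μ := by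
  have h1 := integrable_norm_sq_of_memLp hY
  have h2 : Integrable (fun w => ‖X w - c • Y w‖ ^ 2) μ :=
    integrable_norm_sq_of_memLp (hX.sub (hY.const_smul c))
  rw [← integral_const_mul, ← integral_const_mul, ← integral_add (h1.const_mul _) (h2.const_mul _)]
  refine integral_mono (integrable_norm_sq_of_memLp hX) ((h1.const_mul _).add (h2.const_mul _))
    fun w => ?_
  have := norm_add_sq_le (c • Y w) (X w - c • Y w)
  rw [add_sub_cancel, norm_smul, mul_pow, Real.norm_eq_abs, sq_abs] at this
  linarith

/-- Polarization: `2c⟨Y, X⟩ = ‖X‖² + c²‖Y‖² - ‖X - cY‖²`, with `‖X‖²` dropped. -/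
lemma le_integral_inner_of_sub_smul {E : Type*} [NormedAddCommGroup E] [InnerProductSpace ℝ E]
    {X Y : Ω → E} (hX : MemLp X 2 μ) (hY : MemLp Y 2 μ) {c R : ℝ} (hc : 0 < c)
    (hR : ∫ w, ‖X w - c • Y w‖ ^ 2 ∂μ ≤ c * R) :
    c / 2 * ∫ w, ‖Y w‖ ^ 2 ∂μ - R / 2 ≤ ∫ w, inner ℝ (Y w) (X w) ∂μ := by
  have h1 := integrable_norm_sq_of_memLp hY
  have h2 : Integrable (fun w => ‖X w - c • Y w‖ ^ 2) μ :=
    integrable_norm_sq_of_memLp (hX.sub (hY.const_smul c))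
  have h3 : c / 2 * ∫ w, ‖Y w‖ ^ 2 ∂μ - 1 / (2 * c) * ∫ w, ‖X w - c • Y w‖ ^ 2 ∂μ
      ≤ ∫ w, inner ℝ (Y w) (X w) ∂μ := by
    rw [← integral_const_mul, ← integral_const_mul,
      ← integral_sub (h1.const_mul _) (h2.const_mul _)]
    refine integral_mono ((h1.const_mul _).sub (h2.const_mul _)) (integrable_inner_of_memLp hY hX)
      fun w => ?_
    have e : ‖X w - c • Y w‖ ^ 2 = ‖X w‖ ^ 2 - 2 * c * inner ℝ (Y w) (X w) + c ^ 2 * ‖Y w‖ ^ 2 := by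
      rw [norm_sub_sq_real, real_inner_smul_right, norm_smul, mul_pow, Real.norm_eq_abs, sq_abs,
        real_inner_comm]
      ring
    have e2 : c / 2 * ‖Y w‖ ^ 2 - 1 / (2 * c) * ‖X w - c • Y w‖ ^ 2
        = inner ℝ (Y w) (X w) - 1 / (2 * c) * ‖X w‖ ^ 2 := by
      rw [e]
      field_simp
      ring
    rw [e2, sub_le_self_iff]
    positivity
  have h4 : 1 / (2 * c) * ∫ w, ‖X w - c • Y w‖ ^ 2 ∂μ ≤ R / 2 := by
    calc 1 / (2 * c) * ∫ w, ‖X w - c • Y w‖ ^ 2 ∂μ ≤ 1 / (2 * c) * (c * R) := by gcongr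
      _ = R / 2 := by field_simp
  linarith

lemma round_descent [IsProbabilityMeasure μ] (h : IsClusteredScheme p r) (hm : 0 < m)
    (hS : Measurable S)
    (hlaw : HasLaw S (clusteredLaw r) μ) {loss : Fin n → Model d → ℝ} {L : ℝ≥0}
    {β κ σ ηl a V : ℝ} (ha : 0 ≤ a) (hloss : IsSmoothLoss loss L)
    (hdis : BoundedDissimilarity p loss β κ) {K : ℕ} (hK : 0 < K) {θ θ' : Ω → Model d}
    {y N : Fin n → ℕ → Ω → Model d} (hθ : MemLp θ 2 μ) (hy : ∀ i k, MemLp (y i k) 2 μ)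
    (hN : ∀ i k, MemLp (N i k) 2 μ)
    (hind : IndepFun (fun w => (θ w, fun i k => y i k w)) S μ)
    (hθ' : ∀ w, θ' w = θ w - a • ∑ i, aggWeight (S w) i •
      ∑ k ∈ Finset.range K, (gradient (loss i) (y i k w) + N i k w))
    (hnoise0 : ∫ w, inner ℝ (gradient (globalLoss p loss) (θ w))
      (∑ i, aggWeight (S w) i • ∑ k ∈ Finset.range K, N i k w) ∂μ = 0)
    (hnoise : ∫ w, ‖∑ i, aggWeight (S w) i • ∑ k ∈ Finset.range K, N i k w‖ ^ 2 ∂μ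
      ≤ V * K * σ ^ 2)
    (hdrift : ∀ i, ∑ k ∈ Finset.range K, ∫ w, ‖y i k w - θ w‖ ^ 2 ∂μ
      ≤ 2 * ηl ^ 2 * K * (K - 1) * σ ^ 2
        + 4 * ηl ^ 2 * K ^ 2 * (K - 1) * ∫ w, ‖gradient (loss i) (θ w)‖ ^ 2 ∂μ)
    (hf : Integrable (fun w => globalLoss p loss (θ w)) μ)
    (hf' : Integrable (fun w => globalLoss p loss (θ' w)) μ)
    (h1 : β ^ 2 * ηl ^ 2 * L ^ 2 * K ^ 2 ≤ 1 / 32) (h2 : L * a * (1 - 1 / m) * K ≤ 1 / 32)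
    (h3 : L * a * K * (1 / m) * β ^ 2 ≤ 1 / 32) :
    a * K / 4 * ∫ w, ‖gradient (globalLoss p loss) (θ w)‖ ^ 2 ∂μ
      ≤ ∫ w, globalLoss p loss (θ w) ∂μ - ∫ w, globalLoss p loss (θ' w) ∂μ
      + a * (2 * L ^ 2 * ηl ^ 2 * K * (K - 1) * σ ^ 2
        + 4 * L ^ 2 * ηl ^ 2 * K ^ 2 * (K - 1) * κ ^ 2) + L * a ^ 2 * K * V * σ ^ 2
      + 2 * L * a ^ 2 * K ^ 2 * (1 / m) * κ ^ 2 := by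
  have hp := h.importance_nonneg hm
  have hp1 := h.sum_importance hm
  have hm1 : (1 : ℝ) / m ≤ 1 := by
    rw [div_le_one (by exact_mod_cast hm)]; exact_mod_cast hm
  have hGL := hloss.lipschitzWith_gradient_globalLoss hp hp1
  have hGθ : MemLp (fun w => gradient (globalLoss p loss) (θ w)) 2 μ :=
    memLp_comp_of_lipschitzWith hGL hθ
  have hGi : ∀ i, MemLp (fun w => gradient (loss i) (θ w)) 2 μ := fun i =>
    memLp_comp_of_lipschitzWith (hloss i).2 hθ
  set H : Fin n → Ω → Model d := fun i w => ∑ k ∈ Finset.range K, gradient (loss i) (y i k w)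
    with hH
  have hH2 : ∀ i, MemLp (H i) 2 μ := fun i => memLp_finsetSum _ fun k _ =>
    memLp_comp_of_lipschitzWith (hloss i).2 (hy i k)
  have hpH : MemLp (fun w => ∑ i, p i • H i w) 2 μ :=
    memLp_finsetSum _ fun i _ => (hH2 i).const_smul (p i)
  have hAH : MemLp (fun w => ∑ i, aggWeight (S w) i • H i w) 2 μ :=
    memLp_finsetSum _ fun i _ => memLp_aggWeight_smul hS i (hH2 i)
  have hAN : MemLp (fun w => ∑ i, aggWeight (S w) i • ∑ k ∈ Finset.range K, N i k w) 2 μ :=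
    memLp_finsetSum _ fun i _ => memLp_aggWeight_smul hS i (memLp_finsetSum _ fun k _ => hN i k)
  have hgm : ∀ i, Measurable (gradient (loss i)) := fun i => (hloss i).2.continuous.measurable
  have hind' : IndepFun (fun w => (gradient (globalLoss p loss) (θ w), fun i => H i w)) S μ := by
    refine hind.comp (φ := fun z : Model d × (Fin n → ℕ → Model d) =>
      (gradient (globalLoss p loss) z.1, fun i => ∑ k ∈ Finset.range K,
      gradient (loss i) (z.2 i k)))
      ?_ measurable_id
    refine (hGL.continuous.measurable.comp measurable_fst).prodMk (measurable_pi_lambda _ fun i =>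
      Finset.measurable_fun_sum _ fun k _ => (hgm i).comp ?_)
    exact (measurable_pi_apply k).comp ((measurable_pi_apply i).comp measurable_snd)
  set X : Fin n → ℝ := fun i => ∑ k ∈ Finset.range K, ∫ w, ‖y i k w - θ w‖ ^ 2 ∂μ with hX
  have hX0 : ∀ i, 0 ≤ X i := fun i => Finset.sum_nonneg fun k _ => integral_nonneg fun _ =>
      sq_nonneg _
  have hHi : ∀ i, ∫ w, ‖H i w - (K : ℝ) • gradient (loss i) (θ w)‖ ^ 2 ∂μ ≤ K * (L ^ 2 * X i) :=
    fun i => integral_norm_sub_smul_sq_le (hloss i).2 hθ (hy i)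
  -- Convexity of the squared norm, with weights `p i`, reduces the averaged error to the clientwise
  -- errors `hHi`.
  have hpHK : ∫ w, ‖∑ i, p i • H i w - (K : ℝ) • gradient (globalLoss p loss) (θ w)‖ ^ 2 ∂μ
      ≤ K * (L ^ 2 * ∑ i, p i * X i) := by
    have hi : ∀ i, Integrable (fun w => ‖H i w - (K : ℝ) • gradient (loss i) (θ w)‖ ^ 2) μ :=
      fun i => integrable_norm_sq_of_memLp ((hH2 i).sub ((hGi i).const_smul (K : ℝ)))
    calc ∫ w, ‖∑ i, p i • H i w - (K : ℝ) • gradient (globalLoss p loss) (θ w)‖ ^ 2 ∂μ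
        ≤ ∫ w, ∑ i, p i * ‖H i w - (K : ℝ) • gradient (loss i) (θ w)‖ ^ 2 ∂μ := by
          refine integral_mono_of_nonneg (ae_of_all _ fun w => sq_nonneg _)
            (integrable_finsetSum _ fun i _ => (hi i).const_mul _) (ae_of_all _ fun w => ?_)
          have e : ∑ i, p i • H i w - (K : ℝ) • gradient (globalLoss p loss) (θ w)
              = ∑ i, p i • (H i w - (K : ℝ) • gradient (loss i) (θ w)) := by
            simp_rw [hloss.gradient_globalLoss, smul_sub, Finset.sum_sub_distrib, Finset.smul_sum,
              smul_comm (K : ℝ)]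
          simp only [e]
          exact norm_sum_smul_sq_le _ (fun i _ => hp i) hp1 _
      _ = ∑ i, p i * ∫ w, ‖H i w - (K : ℝ) • gradient (loss i) (θ w)‖ ^ 2 ∂μ := by
          rw [integral_finsetSum _ fun i _ => (hi i).const_mul _]
          simp_rw [integral_const_mul]
      _ ≤ ∑ i, p i * (K * (L ^ 2 * X i)) := by
          gcongr with i
          · exact hp i
          · exact hHi i
      _ = _ := by
          simp_rw [Finset.mul_sum]
          exact Finset.sum_congr rfl fun i _ => by ring
  refine descent_of_moment_bounds (I := ∫ w, inner ℝ (gradient (globalLoss p loss) (θ w))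
      (∑ i, p i • H i w) ∂μ) (Q := ∫ w, ‖∑ i, aggWeight (S w) i • H i w‖ ^ 2 ∂μ)
    (Z := ∫ w, ‖∑ i, aggWeight (S w) i • ∑ k ∈ Finset.range K, N i k w‖ ^ 2 ∂μ)
    (R := L ^ 2 * ∑ i, p i * X i) (D := ∑ i, p i * ∫ w, ‖gradient (loss i) (θ w)‖ ^ 2 ∂μ)
    (β := β) ha L.2 (by exact_mod_cast hK) (by positivity) hdis.1
    (integral_nonneg fun _ => sq_nonneg _)
    (mul_nonneg (sq_nonneg _) (Finset.sum_nonneg fun i _ => mul_nonneg (hp i) (hX0 i)))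
    ?_ (le_integral_inner_of_sub_smul hpH hGθ (by exact_mod_cast hK) hpHK) hnoise ?_ ?_ ?_ h1 h2 h3
  · have hi1 := integrable_inner_of_memLp hGθ hAH
    have hi2 := integrable_inner_of_memLp hGθ hAN
    have hi3 := integrable_norm_sq_of_memLp hAH
    have hi4 := integrable_norm_sq_of_memLp hAN
    have hi5 : Integrable (fun w => globalLoss p loss (θ w)
        - a * inner ℝ (gradient (globalLoss p loss) (θ w)) (∑ i, aggWeight (S w) i • H i w)) μ :=
      hf.sub (hi1.const_mul a)
    have hi6 : Integrable (fun w => globalLoss p loss (θ w)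
        - a * inner ℝ (gradient (globalLoss p loss) (θ w)) (∑ i, aggWeight (S w) i • H i w)
        - a * inner ℝ (gradient (globalLoss p loss) (θ w))
          (∑ i, aggWeight (S w) i • ∑ k ∈ Finset.range K, N i k w)) μ :=
      hi5.sub (hi2.const_mul a)
    have hi7 : Integrable (fun w => L * a ^ 2 * ‖∑ i, aggWeight (S w) i • H i w‖ ^ 2
        + L * a ^ 2 * ‖∑ i, aggWeight (S w) i • ∑ k ∈ Finset.range K, N i k w‖ ^ 2) μ :=
      (hi3.const_mul _).add (hi4.const_mul _)
    rw [← h.integral_inner_aggregate hm hS hlaw hGθ hH2 hind']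
    have key : ∫ w, globalLoss p loss (θ' w) ∂μ ≤ ∫ w, ((globalLoss p loss (θ w)
        - a * inner ℝ (gradient (globalLoss p loss) (θ w)) (∑ i, aggWeight (S w) i • H i w))
        - a * inner ℝ (gradient (globalLoss p loss) (θ w))
          (∑ i, aggWeight (S w) i • ∑ k ∈ Finset.range K, N i k w))
        + (L * a ^ 2 * ‖∑ i, aggWeight (S w) i • H i w‖ ^ 2
        + L * a ^ 2 * ‖∑ i, aggWeight (S w) i • ∑ k ∈ Finset.range K, N i k w‖ ^ 2) ∂μ := by
      refine integral_mono hf' (hi6.add hi7) fun w => ?_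
      have e : θ' w = θ w + -(a • (∑ i, aggWeight (S w) i • H i w
          + ∑ i, aggWeight (S w) i • ∑ k ∈ Finset.range K, N i k w)) := by
        rw [hθ', sub_eq_add_neg]
        simp_rw [Finset.sum_add_distrib, smul_add, Finset.sum_add_distrib, hH, smul_add]
      have q1 := le_quadratic_of_lipschitzWith_gradient (hloss.differentiable_globalLoss p) hGL
        (θ w) (-(a • (∑ i, aggWeight (S w) i • H i w
          + ∑ i, aggWeight (S w) i • ∑ k ∈ Finset.range K, N i k w)))
      rw [← e, inner_neg_right, real_inner_smul_right, inner_add_right, norm_neg, norm_smul,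
        mul_pow, Real.norm_eq_abs, sq_abs] at q1
      -- Separating gradients from noise in the square costs a factor `2`, turning `L/2` into `L`.
      have q2 := mul_le_mul_of_nonneg_left (norm_add_sq_le (∑ i, aggWeight (S w) i • H i w)
        (∑ i, aggWeight (S w) i • ∑ k ∈ Finset.range K, N i k w))
        (by positivity : 0 ≤ (L : ℝ) / 2 * a ^ 2)
      linarith
    rw [integral_add hi6 hi7, integral_sub hi5 (hi2.const_mul a), integral_sub hf
      (hi1.const_mul a), integral_add (hi3.const_mul _) (hi4.const_mul _)] at key
    simp_rw [integral_const_mul] at key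
    rw [hnoise0] at key
    linarith
  · refine (h.integral_norm_sq_aggregate_le hm hS hlaw hH2
      (hind'.comp measurable_snd measurable_id)).trans (add_le_add ?_ ?_)
    -- The part of weight `1/m` is bounded client by client and produces `D`; the part of weight `1
    -- - 1/m` involves only the averaged gradient.
    · have e : 1 / (m : ℝ) * (2 * (K : ℝ) ^ 2 * ∑ i, p i * ∫ w, ‖gradient (loss i) (θ w)‖ ^ 2 ∂μ
          + 2 * K * (L ^ 2 * ∑ i, p i * X i))
          = ∑ i, p i / m * (2 * (K : ℝ) ^ 2 * ∫ w, ‖gradient (loss i) (θ w)‖ ^ 2 ∂μ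
            + 2 * (K * (L ^ 2 * X i))) := by
        simp_rw [Finset.mul_sum, ← Finset.sum_add_distrib, Finset.mul_sum]
        exact Finset.sum_congr rfl fun i _ => by ring
      rw [e]
      refine Finset.sum_le_sum fun i _ => mul_le_mul_of_nonneg_left ?_
        (div_nonneg (hp i) (Nat.cast_nonneg _))
      exact (integral_norm_sq_le_of_sub_smul (hH2 i) (hGi i) K).trans (by gcongr; exact hHi i)
    · refine mul_le_mul_of_nonneg_left ?_ (by linarith)
      exact (integral_norm_sq_le_of_sub_smul hpH hGθ K).trans (by linarith [hpHK])
  · have hi : ∀ i, Integrable (fun w => p i * ‖gradient (loss i) (θ w)‖ ^ 2) μ := fun i =>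
      (integrable_norm_sq_of_memLp (hGi i)).const_mul _
    simp_rw [← integral_const_mul]
    rw [← integral_finsetSum _ fun i _ => hi i]
    have hc : Integrable (fun w => β ^ 2 * ‖gradient (globalLoss p loss) (θ w)‖ ^ 2) μ :=
      (integrable_norm_sq_of_memLp hGθ).const_mul _
    refine (integral_mono (integrable_finsetSum _ fun i _ => hi i) (hc.add (integrable_const (κ ^
        2)))
      fun w => ?_).trans_eq ?_
    · have := hdis.2 (θ w)
      rw [← hloss.gradient_globalLoss] at this
      exact this
    · simp only [Pi.add_apply]
      rw [integral_add hc (integrable_const _), integral_const]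
      simp
  · refine mul_le_mul_of_nonneg_left ?_ (sq_nonneg _)
    calc ∑ i, p i * X i ≤ ∑ i, p i * (2 * ηl ^ 2 * K * (K - 1) * σ ^ 2
        + 4 * ηl ^ 2 * K ^ 2 * (K - 1) * ∫ w, ‖gradient (loss i) (θ w)‖ ^ 2 ∂μ) :=
          Finset.sum_le_sum fun i _ => mul_le_mul_of_nonneg_left (hdrift i) (hp i)
      _ = _ := by
        simp_rw [mul_add, Finset.sum_add_distrib, ← Finset.sum_mul, hp1, Finset.mul_sum]
        rw [one_mul]
        congr 1
        exact Finset.sum_congr rfl fun i _ => by ring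

end RoundDescent

/-! ### FedAvg iterates as random variables and their gradient noise. -/

section FedAvg

variable {n m d : ℕ} {Ξ Ω : Type*}

lemma localModel_sub {g : Model d → Ξ → Model d} {ηl : ℝ} (θ : Model d) (b : ℕ → Ξ) (k : ℕ) :
    localModel g ηl θ b k - θ
      = -(ηl • ∑ j ∈ Finset.range k, g (localModel g ηl θ b j) (b j)) := by
  induction k with
  | zero => simp [localModel]
  | succ k ih =>
    rw [localModel, Finset.sum_range_succ, sub_right_comm, ih]
    module

/-- Global model after `t` rounds, as a random variable. -/
noncomputable def randomModel (g : Fin n → Model d → Ξ → Model d) (ηl ηg : ℝ) (K : ℕ) (θ₀ : Model d)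
    (S : ℕ → Ω → Fin m → Fin n) (ξ : ℕ → Fin n → ℕ → Ω → Ξ) (t : ℕ) (w : Ω) : Model d :=
  globalModel g ηl ηg K θ₀ (fun u => S u w) (fun u i k => ξ u i k w) t

/-- Local model of client `i` after `k` steps in round `t`, as a random variable. -/
noncomputable def randomLocalModel (g : Fin n → Model d → Ξ → Model d) (ηl ηg : ℝ) (K : ℕ)
    (θ₀ : Model d)
    (S : ℕ → Ω → Fin m → Fin n) (ξ : ℕ → Fin n → ℕ → Ω → Ξ) (t : ℕ) (i : Fin n) (k : ℕ) (w : Ω) :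
    Model d :=
  localModel (g i) ηl (randomModel g ηl ηg K θ₀ S ξ t w) (fun l => ξ t i l w) k

/-- Error of the stochastic gradient of client `i` at `x` on the batch `b`. -/
noncomputable def gradientNoise (loss : Fin n → Model d → ℝ) (g : Fin n → Model d → Ξ → Model d)
    (i : Fin n) (x : Model d) (b : Ξ) : Model d :=
  g i x b - gradient (loss i) x

/-- Error of the stochastic gradient used by client `i` at step `k` of round `t`. -/
noncomputable def stepNoise (loss : Fin n → Model d → ℝ) (g : Fin n → Model d → Ξ → Model d)
    (ηl ηg : ℝ) (K : ℕ)
    (θ₀ : Model d) (S : ℕ → Ω → Fin m → Fin n) (ξ : ℕ → Fin n → ℕ → Ω → Ξ) (t : ℕ) (i : Fin n)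
    (k : ℕ) (w : Ω) : Model d :=
  gradientNoise loss g i (randomLocalModel g ηl ηg K θ₀ S ξ t i k w) (ξ t i k w)

lemma randomLocalModel_succ (loss : Fin n → Model d → ℝ) (g : Fin n → Model d → Ξ → Model d)
    (ηl ηg : ℝ) (K : ℕ) (θ₀ : Model d) (S : ℕ → Ω → Fin m → Fin n) (ξ : ℕ → Fin n → ℕ → Ω → Ξ)
    (t : ℕ) (i : Fin n) (k : ℕ) (w : Ω) :
    randomLocalModel g ηl ηg K θ₀ S ξ t i (k + 1) w = randomLocalModel g ηl ηg K θ₀ S ξ t i k w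
      - ηl • (gradient (loss i) (randomLocalModel g ηl ηg K θ₀ S ξ t i k w)
        + stepNoise loss g ηl ηg K θ₀ S ξ t i k w) := by
  rw [stepNoise, gradientNoise, add_sub_cancel]
  rfl

lemma randomModel_succ (loss : Fin n → Model d → ℝ) (g : Fin n → Model d → Ξ → Model d)
    (ηl ηg : ℝ) (K : ℕ) (θ₀ : Model d) (S : ℕ → Ω → Fin m → Fin n) (ξ : ℕ → Fin n → ℕ → Ω → Ξ)
    (t : ℕ) (w : Ω) :
    randomModel g ηl ηg K θ₀ S ξ (t + 1) w = randomModel g ηl ηg K θ₀ S ξ t w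
      - (ηg * ηl) • ∑ i, aggWeight (S t w) i • ∑ k ∈ Finset.range K,
        (gradient (loss i) (randomLocalModel g ηl ηg K θ₀ S ξ t i k w)
          + stepNoise loss g ηl ηg K θ₀ S ξ t i k w) := by
  simp only [stepNoise, gradientNoise, add_sub_cancel]
  have e : randomModel g ηl ηg K θ₀ S ξ (t + 1) w = randomModel g ηl ηg K θ₀ S ξ t w
      + ηg • ∑ i, aggWeight (S t w) i •
        (randomLocalModel g ηl ηg K θ₀ S ξ t i K w - randomModel g ηl ηg K θ₀ S ξ t w) := rfl
  rw [e]
  simp_rw [randomLocalModel, localModel_sub, smul_neg, Finset.sum_neg_distrib, smul_neg,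
    sub_eq_add_neg, smul_comm _ ηl, ← Finset.smul_sum, mul_smul]

section Measurability

variable [MeasurableSpace Ξ] {mΩ : MeasurableSpace Ω} {g : Fin n → Model d → Ξ → Model d}
  {S : ℕ → Ω → Fin m → Fin n} {ξ : ℕ → Fin n → ℕ → Ω → Ξ} {t k : ℕ} {i : Fin n}

lemma measurable_aggWeight_smul {S : Ω → Fin m → Fin n} (hS : Measurable S) (i : Fin n)
    {X : Ω → Model d} (hX : Measurable X) : Measurable fun w => aggWeight (S w) i • X w :=
  ((measurable_aggWeight i).comp hS).smul hX

lemma measurable_randomLocalModel (hg : ∀ i, Measurable (Function.uncurry (g i))) (ηl ηg : ℝ)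
    (K : ℕ) (θ₀ : Model d) (hS : ∀ u < t, Measurable (S u))
    (hξ : ∀ u < t, ∀ i k, Measurable (ξ u i k)) (hξt : ∀ l < k, Measurable (ξ t i l)) :
    Measurable (randomLocalModel g ηl ηg K θ₀ S ξ t i k) :=
  measurable_localModel (hg i) ηl (measurable_globalModel hg ηl ηg K θ₀ hS hξ) hξt

lemma measurable_models (hg : ∀ i, Measurable (Function.uncurry (g i))) (ηl ηg : ℝ)
    (K : ℕ) (θ₀ : Model d) (hS : ∀ u < t, Measurable (S u)) (hξ : ∀ u i k, Measurable (ξ u i k)) :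
    Measurable fun w => (randomModel g ηl ηg K θ₀ S ξ t w,
      fun i k => randomLocalModel g ηl ηg K θ₀ S ξ t i k w) :=
  (measurable_globalModel hg ηl ηg K θ₀ hS fun u _ => hξ u).prodMk
    (measurable_pi_lambda _ fun i => measurable_pi_lambda _ fun _ =>
      measurable_randomLocalModel hg ηl ηg K θ₀ hS (fun u _ => hξ u) fun l _ => hξ t i l)

lemma measurable_gradientNoise {loss : Fin n → Model d → ℝ} {L : ℝ≥0} (hloss : IsSmoothLoss loss L)
    (hg : ∀ i, Measurable (Function.uncurry (g i))) (i : Fin n) :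
    Measurable (Function.uncurry (gradientNoise loss g i)) :=
  (hg i).sub ((hloss i).2.continuous.measurable.comp measurable_fst)

lemma measurable_stepNoise {loss : Fin n → Model d → ℝ} {L : ℝ≥0} (hloss : IsSmoothLoss loss L)
    (hg : ∀ i, Measurable (Function.uncurry (g i))) (ηl ηg : ℝ)
    (K : ℕ) (θ₀ : Model d) (hS : ∀ u < t, Measurable (S u))
    (hξ : ∀ u < t, ∀ i k, Measurable (ξ u i k)) (hξt : ∀ l ≤ k, Measurable (ξ t i l)) :
    Measurable (stepNoise loss g ηl ηg K θ₀ S ξ t i k) :=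
  (measurable_gradientNoise hloss hg i).comp
    ((measurable_randomLocalModel hg ηl ηg K θ₀ hS hξ fun l hl => hξt l hl.le).prodMk
      (hξt k le_rfl))

end Measurability

section SigmaAlgebras

variable [MeasurableSpace Ξ] {ν : Fin n → Measure Ξ}
  {loss : Fin n → Model d → ℝ} {L : ℝ≥0} {σ ηl ηg : ℝ} {K : ℕ} {θ₀ : Model d}
  {g : Fin n → Model d → Ξ → Model d} {S : ℕ → Ω → Fin m → Fin n} {ξ : ℕ → Fin n → ℕ → Ω → Ξ}

lemma IsStochasticGradient.integrable_gradientNoise [∀ i, IsProbabilityMeasure (ν i)]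
    (hg : IsStochasticGradient loss ν g σ)
    (i : Fin n) (x : Model d) : Integrable (gradientNoise loss g i x) (ν i) :=
  (hg.integrable i x).sub (integrable_const _)

lemma IsStochasticGradient.integral_gradientNoise [∀ i, IsProbabilityMeasure (ν i)]
    (hg : IsStochasticGradient loss ν g σ)
    (i : Fin n) (x : Model d) : ∫ b, gradientNoise loss g i x b ∂(ν i) = 0 := by
  simp only [gradientNoise]
  rw [integral_sub (hg.integrable i x) (integrable_const _), hg.unbiased, integral_const]
  simp

lemma measurable_sigmaExceptBatch_randomModel (hg : IsStochasticGradient loss ν g σ)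
    (t : ℕ) (i : Fin n) (k : ℕ) :
    Measurable[sigmaExceptBatch S ξ (t, i, k)] (randomModel g ηl ηg K θ₀ S ξ t) :=
  measurable_globalModel hg.measurable ηl ηg K θ₀
    (fun u _ => measurable_sample_sigmaExceptBatch _ u) fun u hu j l =>
      measurable_batch_sigmaExceptBatch (q' := (u, j, l)) (by simp [hu.ne])

lemma measurable_sigmaExceptBatch_randomLocalModel (hg : IsStochasticGradient loss ν g σ)
    (t : ℕ) (i : Fin n) (k : ℕ) :
    Measurable[sigmaExceptBatch S ξ (t, i, k)] (randomLocalModel g ηl ηg K θ₀ S ξ t i k) :=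
  measurable_randomLocalModel hg.measurable ηl ηg K θ₀
    (fun u _ => measurable_sample_sigmaExceptBatch _ u) (fun u hu j l =>
      measurable_batch_sigmaExceptBatch (q' := (u, j, l)) (by simp [hu.ne])) fun l hl =>
      measurable_batch_sigmaExceptBatch (q' := (t, i, l)) (by simp [hl.ne])

/-- Within a round the clients do not interact, so the noise of another client avoids the batch `(t,
i, k)` at every step, while that of client `i` does so only at earlier steps. -/
lemma measurable_sigmaExceptBatch_stepNoise (hloss : IsSmoothLoss loss L)
    (hg : IsStochasticGradient loss ν g σ) (t : ℕ) {i j : Fin n} {k l : ℕ} (h : j ≠ i ∨ l < k) :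
    Measurable[sigmaExceptBatch S ξ (t, i, k)] (stepNoise loss g ηl ηg K θ₀ S ξ t j l) :=
  measurable_stepNoise hloss hg.measurable ηl ηg K θ₀
    (fun u _ => measurable_sample_sigmaExceptBatch _ u) (fun u hu j l =>
      measurable_batch_sigmaExceptBatch (q' := (u, j, l)) (by simp [hu.ne])) fun l' hl' =>
      measurable_batch_sigmaExceptBatch (q' := (t, j, l')) (by
        rcases h with h | h
        · simp [h]
        · simp [(hl'.trans_lt h).ne])

end SigmaAlgebras

/-! ### Moments and orthogonality of the gradient noise. -/

section Moments

variable [MeasurableSpace Ξ] [MeasurableSpace Ω] {μ : Measure Ω}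
  {P : Measure (Fin m → Fin n)} {ν : Fin n → Measure Ξ}
  {loss : Fin n → Model d → ℝ} {L : ℝ≥0} {σ ηl ηg : ℝ} {K : ℕ} {θ₀ : Model d}
  {g : Fin n → Model d → Ξ → Model d} {S : ℕ → Ω → Fin m → Fin n} {ξ : ℕ → Fin n → ℕ → Ω → Ξ}

variable (hR : IsFedAvgRandomness μ P ν S ξ) (hloss : IsSmoothLoss loss L)
  (hg : IsStochasticGradient loss ν g σ)

include hR hg

lemma measurable_randomModel (t : ℕ) : Measurable (randomModel g ηl ηg K θ₀ S ξ t) :=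
  measurable_globalModel hg.measurable ηl ηg K θ₀ (fun u _ => hR.measurable_sample u)
    fun u _ => hR.measurable_batch u

lemma measurable_randomLocalModel' (t : ℕ) (i : Fin n) (k : ℕ) :
    Measurable (randomLocalModel g ηl ηg K θ₀ S ξ t i k) :=
  measurable_randomLocalModel hg.measurable ηl ηg K θ₀ (fun u _ => hR.measurable_sample u)
    (fun u _ => hR.measurable_batch u) fun l _ => hR.measurable_batch t i l

lemma indepFun_models_sample [IsProbabilityMeasure μ] (t : ℕ) :
    IndepFun (fun w => (randomModel g ηl ηg K θ₀ S ξ t w,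
      fun i k => randomLocalModel g ηl ηg K θ₀ S ξ t i k w)) (S t) μ := by
  exact indepFun_of_measurable_of_indep (m := sigmaExceptSample S ξ t)
    (measurable_models hg.measurable ηl ηg K θ₀
      (fun u hu => measurable_sample_sigmaExceptSample hu.ne)
      fun u i k => measurable_batch_sigmaExceptSample t u i k)
    (hR.indep_sigmaExceptSample t)

include hloss

lemma measurable_stepNoise' (t : ℕ) (i : Fin n) (k : ℕ) :
    Measurable (stepNoise loss g ηl ηg K θ₀ S ξ t i k) :=
  measurable_stepNoise hloss hg.measurable ηl ηg K θ₀ (fun u _ => hR.measurable_sample u)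
    (fun u _ => hR.measurable_batch u) fun l _ => hR.measurable_batch t i l

variable [IsProbabilityMeasure μ] [∀ i, IsProbabilityMeasure (ν i)]

lemma memLp_stepNoise (t : ℕ) (i : Fin n) (k : ℕ) :
    MemLp (stepNoise loss g ηl ηg K θ₀ S ξ t i k) 2 μ :=
  memLp_noise (measurable_gradientNoise hloss hg.measurable i) (hg.integrable_sq i)
    (hg.variance_le i) (measurable_randomLocalModel' hR hg t i k) (hR.measurable_batch t i k)
    (hR.law_batch t i k) (indepFun_of_measurable_of_indep
      (measurable_sigmaExceptBatch_randomLocalModel hg t i k) (hR.indep_sigmaExceptBatch (t, i, k)))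

lemma memLp_randomLocalModel {t : ℕ} (hθ : MemLp (randomModel g ηl ηg K θ₀ S ξ t) 2 μ) (i : Fin n)
    (k : ℕ) : MemLp (randomLocalModel g ηl ηg K θ₀ S ξ t i k) 2 μ := by
  induction k with
  | zero => exact hθ
  | succ k ih =>
    have e := funext (randomLocalModel_succ loss g ηl ηg K θ₀ S ξ t i k)
    rw [e]
    exact ih.sub (((memLp_comp_of_lipschitzWith (hloss i).2 ih).add
      (memLp_stepNoise hR hloss hg t i k)).const_smul ηl)

/-- Lipschitz gradients, bounded weights and square-integrable noise preserve square integrability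
at each round, for any learning rates. -/
lemma memLp_randomModel (t : ℕ) : MemLp (randomModel g ηl ηg K θ₀ S ξ t) 2 μ := by
  induction t with
  | zero => exact memLp_const θ₀
  | succ t ih =>
    have e := funext (randomModel_succ loss g ηl ηg K θ₀ S ξ t)
    rw [e]
    have h1 : ∀ i, MemLp (fun w => ∑ k ∈ Finset.range K,
        (gradient (loss i) (randomLocalModel g ηl ηg K θ₀ S ξ t i k w)
          + stepNoise loss g ηl ηg K θ₀ S ξ t i k w)) 2 μ := fun i => memLp_finsetSum _ fun k _ =>
      (memLp_comp_of_lipschitzWith (hloss i).2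
        (memLp_randomLocalModel hR hloss hg ih i k)).add (memLp_stepNoise hR hloss hg t i k)
    have h2 : MemLp (fun w => ∑ i, aggWeight (S t w) i • ∑ k ∈ Finset.range K,
        (gradient (loss i) (randomLocalModel g ηl ηg K θ₀ S ξ t i k w)
          + stepNoise loss g ηl ηg K θ₀ S ξ t i k w)) 2 μ := memLp_finsetSum _ fun i _ =>
      memLp_aggWeight_smul (hR.measurable_sample t) i (h1 i)
    exact ih.sub (h2.const_smul (ηg * ηl))

/-- The excluded σ-algebra contains all samples, including `S t`, so `Z` may carry aggregation
weights of the current round. -/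
lemma integral_inner_stepNoise_eq_zero (t : ℕ) (i : Fin n) (k : ℕ) {Z : Ω → Model d}
    (hZ : Measurable Z) (hZ' : Measurable[sigmaExceptBatch S ξ (t, i, k)] Z) (hZ2 : MemLp Z 2 μ) :
    ∫ w, inner ℝ (Z w) (stepNoise loss g ηl ηg K θ₀ S ξ t i k w) ∂μ = 0 := by
  have hm : Measurable[sigmaExceptBatch S ξ (t, i, k)]
      fun w => (randomLocalModel g ηl ηg K θ₀ S ξ t i k w, Z w) :=
    (measurable_sigmaExceptBatch_randomLocalModel hg t i k).prodMk hZ'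
  have hind := indepFun_of_measurable_of_indep hm (hR.indep_sigmaExceptBatch (t, i, k))
  exact integral_inner_noise_eq_zero (measurable_gradientNoise hloss hg.measurable i)
    (hg.integrable_gradientNoise i) (hg.integral_gradientNoise i)
    (measurable_randomLocalModel' hR hg t i k) hZ (hR.measurable_batch t i k)
    (hR.law_batch t i k) hind hZ2 (memLp_stepNoise hR hloss hg t i k)

lemma integral_weighted_stepNoise_le (t : ℕ) (i : Fin n) (k : ℕ) {W : (Fin m → Fin n) → ℝ}
    (hW : ∀ s, 0 ≤ W s) :
    ∫ w, W (S t w) * ‖stepNoise loss g ηl ηg K θ₀ S ξ t i k w‖ ^ 2 ∂μ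
      ≤ σ ^ 2 * ∫ s, W s ∂P := by
  have hWm : Measurable W := measurable_of_finite W
  have : IsProbabilityMeasure P :=
    (hR.law_sample t).isProbabilityMeasure_iff.1 inferInstance
  have hWi : Integrable (fun w => W (S t w)) μ :=
    ((hR.law_sample t).measurePreserving (hR.measurable_sample t)).integrable_comp_of_integrable
      .of_finite
  refine (integral_weighted_noise_le (measurable_gradientNoise hloss hg.measurable i)
    (hg.integrable_sq i) (hg.variance_le i) (measurable_randomLocalModel' hR hg t i k)
    (hWm.comp (hR.measurable_sample t)) (hR.measurable_batch t i k) (hR.law_batch t i k)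
    (fun w => hW _) hWi (indepFun_of_measurable_of_indep
      ((measurable_sigmaExceptBatch_randomLocalModel hg t i k).prodMk
        (hWm.comp (measurable_sample_sigmaExceptBatch _ t)))
      (hR.indep_sigmaExceptBatch (t, i, k)))).trans_eq ?_
  congr 1
  exact (hR.law_sample t).integral_comp hWm.aestronglyMeasurable

lemma integral_norm_sq_stepNoise_le (t : ℕ) (i : Fin n) (k : ℕ) :
    ∫ w, ‖stepNoise loss g ηl ηg K θ₀ S ξ t i k w‖ ^ 2 ∂μ ≤ σ ^ 2 := by
  have : IsProbabilityMeasure P :=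
    (hR.law_sample t).isProbabilityMeasure_iff.1 inferInstance
  simpa using integral_weighted_stepNoise_le hR hloss hg (ηl := ηl) (ηg := ηg) (K := K) (θ₀ := θ₀)
    t i k (W := fun _ => 1) fun _ => zero_le_one

lemma integral_inner_stepNoise_stepNoise (t : ℕ) (i : Fin n) {j k : ℕ} (hjk : j ≠ k) :
    ∫ w, inner ℝ (stepNoise loss g ηl ηg K θ₀ S ξ t i j w)
      (stepNoise loss g ηl ηg K θ₀ S ξ t i k w) ∂μ = 0 := by
  have key : ∀ {j k : ℕ}, j < k → ∫ w, inner ℝ (stepNoise loss g ηl ηg K θ₀ S ξ t i j w)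
      (stepNoise loss g ηl ηg K θ₀ S ξ t i k w) ∂μ = 0 := fun h =>
    integral_inner_stepNoise_eq_zero hR hloss hg t i _ (measurable_stepNoise' hR hloss hg t i _)
      (measurable_sigmaExceptBatch_stepNoise hloss hg t (Or.inr h))
      (memLp_stepNoise hR hloss hg t i _)
  rcases hjk.lt_or_gt with h | h
  · exact key h
  · exact (integral_congr_ae (ae_of_all _ fun w => real_inner_comm _ _)).trans (key h)

lemma integral_norm_sq_aggregated_noise_le (t : ℕ) :
    ∫ w, ‖∑ i, aggWeight (S t w) i • ∑ k ∈ Finset.range K,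
      stepNoise loss g ηl ηg K θ₀ S ξ t i k w‖ ^ 2 ∂μ
      ≤ (∑ i, ∫ s, aggWeight s i ^ 2 ∂P) * K * σ ^ 2 := by
  set N := stepNoise loss g ηl ηg K θ₀ S ξ with hN
  let f : Fin n × ℕ → Ω → Model d := fun a w => aggWeight (S t w) a.1 • N t a.1 a.2 w
  have hf : ∀ a, MemLp (f a) 2 μ := fun a =>
    memLp_aggWeight_smul (hR.measurable_sample t) _ (memLp_stepNoise hR hloss hg t _ _)
  -- Both weights are moved to the side of `a`, leaving the bare noise `b` against a vector that
  -- does not involve its batch. For one client, the later step must play the role of `b`.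
  have key : ∀ a b : Fin n × ℕ, a.1 ≠ b.1 ∨ a.2 < b.2 → ∫ w, inner ℝ (f a w) (f b w) ∂μ = 0 := by
    intro a b hab
    have := integral_inner_stepNoise_eq_zero hR hloss hg (ηl := ηl) (ηg := ηg) (K := K) (θ₀ := θ₀)
      t b.1 b.2 (Z := fun w => aggWeight (S t w) b.1 • f a w)
      (measurable_aggWeight_smul (hR.measurable_sample t) _ (measurable_aggWeight_smul
        (hR.measurable_sample t) _ (measurable_stepNoise' hR hloss hg t _ _)))
      (measurable_aggWeight_smul (measurable_sample_sigmaExceptBatch _ t) _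
        (measurable_aggWeight_smul (measurable_sample_sigmaExceptBatch _ t) _
          (measurable_sigmaExceptBatch_stepNoise hloss hg t hab)))
      (memLp_aggWeight_smul (hR.measurable_sample t) _ (hf a))
    rw [← this]
    simp only [f, real_inner_smul_left, real_inner_smul_right, hN]
  have horth : ∀ a b, a ≠ b → ∫ w, inner ℝ (f a w) (f b w) ∂μ = 0 := by
    intro a b hab
    by_cases h1 : a.1 = b.1
    · have h2 : a.2 ≠ b.2 := fun h2 => hab (Prod.ext h1 h2)
      rcases h2.lt_or_gt with h | h
      · exact key a b (Or.inr h)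
      · simp_rw [fun w => real_inner_comm (f b w) (f a w)]
        exact key b a (Or.inr h)
    · exact key a b (Or.inl h1)
  have e : ∀ w, ∑ i, aggWeight (S t w) i • ∑ k ∈ Finset.range K, N t i k w
      = ∑ a ∈ Finset.univ ×ˢ Finset.range K, f a w := by
    intro w
    rw [Finset.sum_product]
    simp_rw [Finset.smul_sum, f]
  simp_rw [e]
  rw [integral_norm_sum_sq_of_orthogonal _ (fun a _ => hf a) fun a _ b _ => horth a b,
    Finset.sum_product]
  calc ∑ i, ∑ k ∈ Finset.range K, ∫ w, ‖f (i, k) w‖ ^ 2 ∂μ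
      ≤ ∑ i : Fin n, ∑ _k ∈ Finset.range K, σ ^ 2 * ∫ s, aggWeight s i ^ 2 ∂P := by
        gcongr with i _ k _
        have := integral_weighted_stepNoise_le hR hloss hg (ηl := ηl) (ηg := ηg) (K := K)
          (θ₀ := θ₀) t i k (W := fun s => aggWeight s i ^ 2) fun s => sq_nonneg _
        simpa only [f, norm_smul, mul_pow, Real.norm_eq_abs, sq_abs] using this
    _ = _ := by
        simp_rw [Finset.sum_const, Finset.card_range, nsmul_eq_mul, ← Finset.mul_sum]
        ring

lemma integral_inner_aggregated_noise {v : Model d → Model d} (hv : LipschitzWith L v) (t : ℕ) :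
    ∫ w, inner ℝ (v (randomModel g ηl ηg K θ₀ S ξ t w)) (∑ i, aggWeight (S t w) i •
      ∑ k ∈ Finset.range K, stepNoise loss g ηl ηg K θ₀ S ξ t i k w) ∂μ = 0 := by
  have hv2 : MemLp (fun w => v (randomModel g ηl ηg K θ₀ S ξ t w)) 2 μ :=
    memLp_comp_of_lipschitzWith hv (memLp_randomModel hR hloss hg t)
  have hz : ∀ i k, ∫ w, inner ℝ (aggWeight (S t w) i • v (randomModel g ηl ηg K θ₀ S ξ t w))
      (stepNoise loss g ηl ηg K θ₀ S ξ t i k w) ∂μ = 0 := fun i k =>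
    integral_inner_stepNoise_eq_zero hR hloss hg t i k
      (measurable_aggWeight_smul (hR.measurable_sample t) i
        (hv.continuous.measurable.comp (measurable_randomModel hR hg t)))
      (measurable_aggWeight_smul (measurable_sample_sigmaExceptBatch _ t) i
        (hv.continuous.measurable.comp (measurable_sigmaExceptBatch_randomModel hg t i k)))
      (memLp_aggWeight_smul (hR.measurable_sample t) i hv2)
  have hi : ∀ i k, Integrable (fun w => inner ℝ (aggWeight (S t w) i •
      v (randomModel g ηl ηg K θ₀ S ξ t w)) (stepNoise loss g ηl ηg K θ₀ S ξ t i k w)) μ :=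
    fun i k => integrable_inner_of_memLp (memLp_aggWeight_smul (hR.measurable_sample t) i hv2)
      (memLp_stepNoise hR hloss hg t i k)
  simp_rw [inner_sum, real_inner_smul_right, ← real_inner_smul_left, inner_sum]
  rw [integral_finsetSum _ fun i _ => integrable_finsetSum _ fun k _ => hi i k]
  refine Finset.sum_eq_zero fun i _ => ?_
  rw [integral_finsetSum _ fun k _ => hi i k]
  exact Finset.sum_eq_zero fun k _ => hz i k

end Moments

end FedAvg

/-! ### Summation over the rounds. -/

section Convergence

variable {n m d : ℕ} {Ξ Ω : Type*} [MeasurableSpace Ξ] [MeasurableSpace Ω] {p : Fin n → ℝ}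
  {r : Fin m → Fin n → ℝ} {loss : Fin n → Model d → ℝ} {L : ℝ≥0} {β κ σ ηl ηg : ℝ}
  {θ₀ θopt : Model d} {μ : Measure Ω} [IsProbabilityMeasure μ] {ν : Fin n → Measure Ξ}
  [∀ i, IsProbabilityMeasure (ν i)] {g : Fin n → Model d → Ξ → Model d}
  {S : ℕ → Ω → Fin m → Fin n} {ξ : ℕ → Fin n → ℕ → Ω → Ξ} {K : ℕ}

lemma IsClusteredScheme.sum_integral_aggWeight_sq (h : IsClusteredScheme p r) (hm : 0 < m) :
    ∑ i, ∫ s, aggWeight s i ^ 2 ∂(clusteredLaw r)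
      = 1 / m - 1 / (m : ℝ) ^ 2 * ∑ i, ∑ k, r k i ^ 2 + ∑ i, p i ^ 2 := by
  simp_rw [sq (aggWeight _ _), h.integral_aggWeight_mul hm, if_true, ← sq, Finset.sum_sub_distrib,
    Finset.sum_add_distrib, ← Finset.mul_sum, ← Finset.sum_div, h.sum_importance hm]
  ring

lemma integrable_norm_sq_gradient_randomModel (hp : ∀ i, 0 ≤ p i) (hp1 : ∑ i, p i = 1)
    (hloss : IsSmoothLoss loss L) (hg : IsStochasticGradient loss ν g σ)
    {P : Measure (Fin m → Fin n)} (hR : IsFedAvgRandomness μ P ν S ξ) (t : ℕ) :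
    Integrable (fun w =>
      ‖gradient (globalLoss p loss) (randomModel g ηl ηg K θ₀ S ξ t w)‖ ^ 2) μ :=
  integrable_norm_sq_of_memLp (memLp_comp_of_lipschitzWith
    (hloss.lipschitzWith_gradient_globalLoss hp hp1) (memLp_randomModel hR hloss hg t))

lemma fedAvg_round_descent (h : IsClusteredScheme p r) (hm : 0 < m) (hK : 0 < K) (hηl : 0 < ηl)
    (hηg : 0 < ηg) (hloss : IsSmoothLoss loss L) (hdis : BoundedDissimilarity p loss β κ)
    (hg : IsStochasticGradient loss ν g σ) (hR : IsFedAvgRandomness μ (clusteredLaw r) ν S ξ)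
    (hopt : ∀ x, globalLoss p loss θopt ≤ globalLoss p loss x)
    (h1 : β ^ 2 * ηl ^ 2 * L ^ 2 * K ^ 2 ≤ 1 / 32)
    (h2 : L * ηg * ηl * (1 - 1 / m) * K ≤ 1 / 32)
    (h3 : L * ηg * ηl * K * (1 / m) * β ^ 2 ≤ 1 / 32) (t : ℕ) :
    ηg * ηl * K / 4 * ∫ w, ‖gradient (globalLoss p loss)
        (randomModel g ηl ηg K θ₀ S ξ t w)‖ ^ 2 ∂μ
      ≤ ∫ w, globalLoss p loss (randomModel g ηl ηg K θ₀ S ξ t w) ∂μ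
        - ∫ w, globalLoss p loss (randomModel g ηl ηg K θ₀ S ξ (t + 1) w) ∂μ
      + ηg * ηl * (2 * L ^ 2 * ηl ^ 2 * K * (K - 1) * σ ^ 2
        + 4 * L ^ 2 * ηl ^ 2 * K ^ 2 * (K - 1) * κ ^ 2)
      + L * (ηg * ηl) ^ 2 * K
        * (1 / m - 1 / (m : ℝ) ^ 2 * ∑ i, ∑ k, r k i ^ 2 + ∑ i, p i ^ 2) * σ ^ 2
      + 2 * L * (ηg * ηl) ^ 2 * K ^ 2 * (1 / m) * κ ^ 2 := by
  have hp := h.importance_nonneg hm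
  have hp1 := h.sum_importance hm
  have hGL := hloss.lipschitzWith_gradient_globalLoss hp hp1
  have hθ := memLp_randomModel hR hloss hg (ηl := ηl) (ηg := ηg) (K := K) (θ₀ := θ₀)
  have hy := fun i k => memLp_randomLocalModel hR hloss hg (hθ t) i k
  have hN := fun i k => memLp_stepNoise hR hloss hg (ηl := ηl) (ηg := ηg) (K := K) (θ₀ := θ₀) t i k
  have hint := fun t => integrable_comp_of_quadratic (hloss.differentiable_globalLoss p) hGL hopt
    (hθ t)
  -- The drift bound needs this condition without `β²`, which can be dropped as `β² ≥ 1`.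
  have hη : ηl ^ 2 * (L : ℝ) ^ 2 * K ^ 2 ≤ 1 / 32 := by
    refine le_trans ?_ h1
    rw [mul_assoc, mul_assoc, mul_assoc]
    exact le_mul_of_one_le_left (by positivity) hdis.1
  refine round_descent h hm (hR.measurable_sample t) (hR.law_sample t) (mul_pos hηg hηl).le hloss
    hdis hK (hθ t) hy hN (indepFun_models_sample hR hg t)
    (randomModel_succ loss g ηl ηg K θ₀ S ξ t)
    (integral_inner_aggregated_noise hR hloss hg hGL t)
    ((integral_norm_sq_aggregated_noise_le hR hloss hg t).trans_eq
      (by rw [h.sum_integral_aggWeight_sq hm])) (fun i => ?_) (hint t) (hint (t + 1)) h1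
    (by simpa only [mul_assoc] using h2) (by simpa only [mul_assoc] using h3)
  exact local_drift_le (hloss i).2 (randomLocalModel_succ loss g ηl ηg K θ₀ S ξ t i) (hy i) (hN i)
    (fun j k hjk => integral_inner_stepNoise_stepNoise hR hloss hg t i hjk)
    (integral_norm_sq_stepNoise_le hR hloss hg t i) hK hη

lemma convBound_mono_coefA {gap σ κ ηl ηg L : ℝ} {K T m : ℕ} {A A' D E : ℝ} (hL : 0 ≤ L)
    (hηl : 0 ≤ ηl) (hηg : 0 ≤ ηg) (hA : A ≤ A') :
    convBound gap L σ κ ηl ηg K T m A D E ≤ convBound gap L σ κ ηl ηg K T m A' D E := by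
  unfold convBound
  gcongr

lemma fedAvg_convergence (h : IsClusteredScheme p r) (hm : 0 < m) (hK : 0 < K) {T : ℕ}
    (hT : 0 < T) (hηl : 0 < ηl) (hηg : 0 < ηg) (hloss : IsSmoothLoss loss L)
    (hdis : BoundedDissimilarity p loss β κ) (hg : IsStochasticGradient loss ν g σ)
    (hR : IsFedAvgRandomness μ (clusteredLaw r) ν S ξ)
    (hopt : ∀ x, globalLoss p loss θopt ≤ globalLoss p loss x)
    (h1 : β ^ 2 * ηl ^ 2 * L ^ 2 * K ^ 2 ≤ 1 / 32)
    (h2 : L * ηg * ηl * (1 - 1 / m) * K ≤ 1 / 32)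
    (h3 : L * ηg * ηl * K * (1 / m) * β ^ 2 ≤ 1 / 32) :
    1 / (T : ℝ) * ∑ t ∈ Finset.range T, ∫ w, ‖gradient (globalLoss p loss)
        (randomModel g ηl ηg K θ₀ S ξ t w)‖ ^ 2 ∂μ
      ≤ 16 * convBound (globalLoss p loss θ₀ - globalLoss p loss θopt) L σ κ ηl ηg K T m
        (m * (1 / m - 1 / (m : ℝ) ^ 2 * ∑ i, ∑ k, r k i ^ 2 + ∑ i, p i ^ 2))
        (1 / m * ((K : ℝ) - 1)) (1 / m * (K : ℝ)) := by
  have hp := h.importance_nonneg hm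
  have hp1 := h.sum_importance hm
  set V : ℝ := 1 / m - 1 / (m : ℝ) ^ 2 * ∑ i, ∑ k, r k i ^ 2 + ∑ i, p i ^ 2 with hVdef
  have hV : 0 ≤ V := by
    rw [hVdef, ← h.sum_integral_aggWeight_sq hm]
    exact Finset.sum_nonneg fun i _ => integral_nonneg fun s => sq_nonneg _
  have hround := fun t => fedAvg_round_descent h hm hK hηl hηg hloss hdis hg hR hopt h1 h2 h3
    (θ₀ := θ₀) t
  set F : ℕ → ℝ := fun t => ∫ w, globalLoss p loss (randomModel g ηl ηg K θ₀ S ξ t w) ∂μ with hF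
  set G : ℕ → ℝ := fun t => ∫ w, ‖gradient (globalLoss p loss)
    (randomModel g ηl ηg K θ₀ S ξ t w)‖ ^ 2 ∂μ with hG
  have hF0 : F 0 = globalLoss p loss θ₀ := by
    simp [hF, randomModel, globalModel]
  have hFT : globalLoss p loss θopt ≤ F T := by
    have hint := integrable_comp_of_quadratic (hloss.differentiable_globalLoss p)
      (hloss.lipschitzWith_gradient_globalLoss hp hp1) hopt
      (memLp_randomModel hR hloss hg (ηl := ηl) (ηg := ηg) (K := K) (θ₀ := θ₀) T)
    calc globalLoss p loss θopt = ∫ _, globalLoss p loss θopt ∂μ := by simp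
      _ ≤ F T := integral_mono (integrable_const _) hint fun w => hopt _
  have hsum := Finset.sum_le_sum fun t (_ : t ∈ Finset.range T) => hround t
  simp only [Finset.sum_add_distrib, Finset.sum_range_sub', ← Finset.mul_sum, Finset.sum_const,
    Finset.card_range, nsmul_eq_mul] at hsum
  have hgap : 0 ≤ globalLoss p loss θ₀ - globalLoss p loss θopt := sub_nonneg.2 (hopt θ₀)
  set gap := globalLoss p loss θ₀ - globalLoss p loss θopt
  have hm0 : (0 : ℝ) < m := by exact_mod_cast hm
  have hT0 : (0 : ℝ) < T := by exact_mod_cast hT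
  have hK1 : (1 : ℝ) ≤ K := by exact_mod_cast hK
  have hK0 : (0 : ℝ) < K := by linarith
  have hKs : (0 : ℝ) ≤ K - 1 := by linarith
  have hL := L.2
  have hpos : 0 < ηg * ηl * K / 4 := by positivity
  -- The telescoped bound, written with the common factor `ηg ηl K / 4` so that it cancels. The
  -- constants `4, 8, 16, 4, 8` then multiply terms of `convBound`.
  have hbound : ηg * ηl * K / 4 * ∑ t ∈ Finset.range T, G t ≤ ηg * ηl * K / 4 * (T *
      (4 * (gap / (ηg * ηl * K * T)) + 8 * (L ^ 2 * ηl ^ 2 * (K - 1) * σ ^ 2)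
        + 16 * (L ^ 2 * ηl ^ 2 * (K * (K - 1)) * κ ^ 2) + 4 * (L * (ηg * ηl) * V * σ ^ 2)
        + 8 * (L * (ηg * ηl) * (1 / m * K) * κ ^ 2))) := by
    refine hsum.trans ((by linarith : _ ≤ gap + T * (ηg * ηl * (2 * L ^ 2 * ηl ^ 2 * K * (K - 1)
      * σ ^ 2 + 4 * L ^ 2 * ηl ^ 2 * K ^ 2 * (K - 1) * κ ^ 2)) + T * (L * (ηg * ηl) ^ 2 * K * V
      * σ ^ 2) + T * (2 * L * (ηg * ηl) ^ 2 * K ^ 2 * (1 / m) * κ ^ 2)).trans_eq ?_)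
    field_simp
    ring
  have hbound' := le_of_mul_le_mul_left hbound hpos
  rw [one_div_mul_eq_div, div_le_iff₀' hT0]
  refine hbound'.trans (mul_le_mul_of_nonneg_left ?_ hT0.le)
  unfold convBound coefB coefC
  have e : L * (ηg * ηl) * (1 / m) * (m * V) * σ ^ 2 = L * (ηg * ηl) * V * σ ^ 2 := by
    field_simp
  rw [e]
  have q1 : 0 ≤ gap / (ηg * ηl * K * T) := by positivity
  have q2 : 0 ≤ L ^ 2 * ηl ^ 2 * (K - 1) * σ ^ 2 := by positivity
  have q3 : 0 ≤ L * (ηg * ηl) * V * σ ^ 2 := by positivity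
  have q4 : 0 ≤ L * (ηg * ηl) * (1 / m * K) * κ ^ 2 := by positivity
  -- The `D` term is only added as a nonnegative slack: its source was already absorbed into the
  -- drift.
  have q5 : 0 ≤ L * (ηg * ηl) * (1 / m * ((K : ℝ) - 1)) * σ ^ 2 := by positivity
  linarith

end Convergence

end FL

theorem mainTheorem3 :
    -- aggregation weight statistics of clustered sampling, compared with MD sampling
    (∀ (n m d : ℕ) (p : Fin n → ℝ) (r : Fin m → Fin n → ℝ), 0 < m → FL.IsClusteredScheme p r →
      (∀ i, ∫ s, FL.aggWeight s i ∂(FL.clusteredLaw r) = p i) ∧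
      FL.coefA (FL.clusteredLaw r) p
        = m * (1 / m - 1 / (m : ℝ) ^ 2 * ∑ i, ∑ k, r k i ^ 2 + ∑ i, p i ^ 2) ∧
      FL.coefA (FL.clusteredLaw r) p ≤ FL.coefA (FL.mdLaw m p) p ∧
      (∀ i j, i ≠ j → covariance (fun s => FL.aggWeight s i) (fun s => FL.aggWeight s j)
        (FL.mdLaw m p) = -(FL.alphaMD m) * p i * p j) ∧
      (∀ K : ℕ, FL.coefD (FL.mdLaw m p) (FL.alphaMD m) p K = 1 / m * ((K : ℝ) - 1) ∧
        FL.coefE (FL.mdLaw m p) (FL.alphaMD m) p K = 1 / m * (K : ℝ)) ∧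
      (∀ x : Fin n → FL.Model d,
        (∫ s, ‖∑ i, FL.aggWeight s i • x i‖ ^ 2 ∂(FL.clusteredLaw r)
          ≤ ∑ i, FL.gammaStat (FL.mdLaw m p) (FL.alphaMD m) p i * ‖x i‖ ^ 2
            + (1 - FL.alphaMD m) * ‖∑ i, p i • x i‖ ^ 2) ∧
        (∫ s, ‖∑ i, FL.aggWeight s i • x i‖ ^ 2 ∂(FL.clusteredLaw r)
          = ∑ i, FL.gammaStat (FL.mdLaw m p) (FL.alphaMD m) p i * ‖x i‖ ^ 2
            + (1 - FL.alphaMD m) * ‖∑ i, p i • x i‖ ^ 2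
          ↔ ∀ k l, ∑ i, r k i • x i = ∑ i, r l i • x i))) ∧
    -- convergence of FedAvg with clustered sampling, with absolute constants `c` and `M`
    ∃ c M : ℝ, 0 < c ∧ 0 < M ∧
      ∀ (n m d K T : ℕ) (p : Fin n → ℝ) (r : Fin m → Fin n → ℝ)
        (loss : Fin n → FL.Model d → ℝ) (L : ℝ≥0) (β κ σ ηl ηg : ℝ) (θ₀ θopt : FL.Model d)
        (Ξ Ω : Type*) [MeasurableSpace Ξ] [MeasurableSpace Ω]
        (μ : Measure Ω) [IsProbabilityMeasure μ]
        (ν : Fin n → Measure Ξ) [∀ i, IsProbabilityMeasure (ν i)]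
        (g : Fin n → FL.Model d → Ξ → FL.Model d)
        (S : ℕ → Ω → Fin m → Fin n) (ξ : ℕ → Fin n → ℕ → Ω → Ξ),
        0 < m → 0 < K → 0 < T → 0 < ηl → 0 < ηg →
        FL.IsClusteredScheme p r →
        FL.IsSmoothLoss loss L →
        FL.BoundedDissimilarity p loss β κ →
        FL.IsStochasticGradient loss ν g σ →
        FL.IsFedAvgRandomness μ (FL.clusteredLaw r) ν S ξ →
        (∀ x, FL.globalLoss p loss θopt ≤ FL.globalLoss p loss x) →
        -- sufficiently small learning rates
        β ^ 2 * ηl ^ 2 * L ^ 2 * K ^ 2 ≤ c →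
        L * ηg * ηl * (1 - FL.alphaMD m) * K ≤ c →
        L * ηg * ηl * K * (∑ i, FL.gammaStat (FL.mdLaw m p) (FL.alphaMD m) p i) * β ^ 2 ≤ c →
        (∀ t, Integrable (fun w => ‖gradient (FL.globalLoss p loss)
          (FL.globalModel g ηl ηg K θ₀ (fun u => S u w) (fun u i k => ξ u i k w) t)‖ ^ 2) μ) ∧
        1 / (T : ℝ) * ∑ t ∈ Finset.range T, ∫ w, ‖gradient (FL.globalLoss p loss)
          (FL.globalModel g ηl ηg K θ₀ (fun u => S u w) (fun u i k => ξ u i k w) t)‖ ^ 2 ∂μ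
          ≤ M * FL.convBound (FL.globalLoss p loss θ₀ - FL.globalLoss p loss θopt) L σ κ ηl ηg
              K T m
              (m * (1 / m - 1 / (m : ℝ) ^ 2 * ∑ i, ∑ k, r k i ^ 2 + ∑ i, p i ^ 2))
              (1 / m * ((K : ℝ) - 1)) (1 / m * (K : ℝ)) ∧
        FL.convBound (FL.globalLoss p loss θ₀ - FL.globalLoss p loss θopt) L σ κ ηl ηg K T m
            (m * (1 / m - 1 / (m : ℝ) ^ 2 * ∑ i, ∑ k, r k i ^ 2 + ∑ i, p i ^ 2))
            (1 / m * ((K : ℝ) - 1)) (1 / m * (K : ℝ))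
          ≤ FL.convBound (FL.globalLoss p loss θ₀ - FL.globalLoss p loss θopt) L σ κ ηl ηg K T m
            (FL.coefA (FL.mdLaw m p) p) (FL.coefD (FL.mdLaw m p) (FL.alphaMD m) p K)
            (FL.coefE (FL.mdLaw m p) (FL.alphaMD m) p K) := by
  -- `c = 1/32` is the threshold of the absorption steps; `M = 16` is the largest coefficient after
  -- division by `ηg ηl K / 4`, attained by the `κ²` drift term.
  refine ⟨fun n m d p r hm h => ⟨h.integral_aggWeight hm, h.coefA_eq hm, h.coefA_le hm,
    fun i j hij => h.covariance_md hm hij, fun K => ?_,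
    fun x => ⟨h.jensen_le hm x, h.jensen_eq_iff hm x⟩⟩, 1 / 32, 16, by norm_num, by norm_num, ?_⟩
  · rw [FL.coefD, FL.coefE, h.sum_gammaStat_md hm]
    exact ⟨mul_comm _ _, mul_comm _ _⟩
  · intro n m d K T p r loss L β κ σ ηl ηg θ₀ θopt Ξ Ω _ _ μ _ ν _ g S ξ hm hK hT hηl hηg h hloss
      hdis hg hR hopt h1 h2 h3
    rw [h.sum_gammaStat_md hm] at h3
    refine ⟨FL.integrable_norm_sq_gradient_randomModel (h.importance_nonneg hm)
      (h.sum_importance hm) hloss hg hR,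
      FL.fedAvg_convergence h hm hK hT hηl hηg hloss hdis hg hR hopt h1 h2 h3, ?_⟩
    rw [FL.coefD, FL.coefE, h.sum_gammaStat_md hm, mul_comm (1 / (m : ℝ)), mul_comm (1 / (m : ℝ)),
      ← h.coefA_eq hm]
    exact FL.convBound_mono_coefA L.2 hηl.le hηg.le (h.coefA_le hm)
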